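/- Graphs $G=(V,E,X)$ are finite, simple and undirected, with a node feature $X_v$ for each $v\in V$; two graphs that are compared have features in a common set. **$k,l$-WL.** Let $k\ge 2$, $l\ge 0$. For $\mathbf u\in V^l$ let $G^{\mathbf u}$ be $G$ with the feature of each node $x$ replaced by $(X_x,\{i : \mathbf u_i=x\})$. On a graph $F$ with node set $V$ (here $F=G^{\mathbf u}$), the initial color $c_k^0(\mathbf v,F)$ of $\mathbf v\in V^k$ is its isomorphism type: the features of $\mathbf v_1,\dots,\mathbf v_k$, together with the pairs $(i,j)$ with $\mathbf v_i=\mathbf v_j$ and the pairs $(i,j)$ with $\mathbf v_i\mathbf v_j\in E$. Further, $$c_k^{t+1}(\mathbf v,F)=\Big(c_k^{t}(\mathbf v,F),\ \big(\{\!\{c_k^{t}(\psi_i(\mathbf v,w),F): w\in V\}\!\}\big)_{i=1}^k\Big),$$ where $\psi_i(\mathbf v,w)$ is $\mathbf v$ with its $i$-th entry replaced by $w$. Put $c_k^t(F)=\{\!\{c_k^t(\mathbf v,F):\mathbf v\in V^k\}\!\}$ and $c_{k,l}^t(G)=\{\!\{c_k^t(G^{\mathbf u}):\mathbf u\in V^l\}\!\}$.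 Then $k,l$-WL *distinguishes* $G$ and $H$ if $c_{k,l}^t(G)\neq c_{k,l}^t(H)$ for some $t$ (equivalently, for an iteration $t$ at which the tuple colors on the two graphs are stable). For algorithms $A,B$ write $B\prec A$ if every pair of graphs distinguished by $B$ is distinguished by $A$, and some pair of graphs is distinguished by $A$ but not by $B$. **The graphs.** Let $K_n$ be the complete graph on $\{1,\dots,n\}$. For a set $T$ of edges of $K_n$, let $\omega_T(K_n)$ have the *string nodes* $(v,S)$ for each node $v$ and each $S\subseteq\{1,\dots,n\}\setminus\{v\}$, and the *bit nodes* $a(v,w),b(v,w)$ for each ordered pair $v\ne w$. The string node $(v,S)$ is adjacent to $b(v,w)$ for $w\in S$ and to $a(v,w)$ for $w\notin S$, $w\neq v$. For an edge $vw\notin T$ the pairs $a(v,w)a(w,v)$ and $b(v,w)b(w,v)$ are edges; for $vw\in T$ ("twisted" edge) the pairs $a(v,w)b(w,v)$ and $b(v,w)a(w,v)$ are edges instead. The color of $(v,S)$ is $v$ (marked as string); the color of $a(v,w)$ and of $b(v,w)$ is $(v,w)$ (marked as bit). Let $\chi_T(K_n)$ be the subgraph induced by the bit nodes and the string nodes $(v,S)$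 with $|S|$ even. For $k\ge2$ let $H_k=\chi_\emptyset(K_{k+1})$ and $G_k=\chi_{\{e\}}(K_{k+1})$, where $e$ is an edge of $K_{k+1}$. The graph $\gamma_{k,T}(K_n)$ arises from $\omega_T(K_n)$ by adding for each string node $(v,S)$ its own disjoint copy (branch) of $G_k$ if $|S|$ is even and of $H_k$ if $|S|$ is odd, and joining $(v,S)$ to all nodes of that copy; a branch node has as its color $v$, a mark that it belongs to a branch, and its color in $G_k$ or $H_k$. Write $\gamma_k(K_n)=\gamma_{k,\emptyset}(K_n)$ and $\tilde\gamma_k(K_n)=\gamma_{k,\{f\}}(K_n)$ for an edge $f$ of $K_n$. **Theorem.** Let $k\ge 2$ and $l\ge 0$. Then $k,l{+}1$-WL $\prec$ $k{+}1,l$-WL. Moreover, for every choice of the edge $e$ of $K_{k+1}$ and of the edge $f$ of $K_{k+l+1}$, $k,l{+}1$-WL does not distinguish $\gamma_k(K_{k+l+1})$ and $\tilde\gamma_k(K_{k+l+1})$, while $k{+}1,l$-WL does. -/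

import Mathlib

/-- A finite undirected graph `(V, E, X)` whose nodes carry features in `C`. -/
structure LGraph (C : Type) where
  V : Type
  [fintypeV : Fintype V]
  graph : SimpleGraph V
  X : V → C

attribute [instance] LGraph.fintypeV

namespace LGraph

variable {C : Type}

/-- The labeled graph `G^v`: the node `v i` receives the extra label `i`. -/
def label (G : LGraph C) {l : ℕ} (v : Fin l → G.V) : LGraph (C × Set (Fin l)) where
  V := G.V
  graph := G.graph
  X := fun u => (G.X u, {i | v i = u})

end LGraph

/-! ### The `k`-WL and `k,l`-WL colorings

Every hash function is taken to be injective, so a color is the data that would be hashed. -/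

/-- Isomorphism types of `k`-tuples: the equality pattern, the features, and the edge pattern. -/
abbrev IsoType (C : Type) (k : ℕ) : Type :=
  (Fin k → Fin k → Prop) × (Fin k → C) × (Fin k → Fin k → Prop)

def LGraph.isoType {C : Type} (G : LGraph C) {k : ℕ} (v : Fin k → G.V) : IsoType C k :=
  (fun i j => v i = v j, fun i => G.X (v i), fun i j => G.graph.Adj (v i) (v j))

/-- The colors of `k`-tuples at iteration `t` of `k`-WL. -/
def TupleColor (C : Type) (k : ℕ) : ℕ → Type
  | 0 => IsoType C k
  | t + 1 => TupleColor C k t × (Fin k → Multiset (TupleColor C k t))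

/-- The color `c_k^t(v, G)` of the `k`-tuple `v` (for `k ≥ 2`; the usual `1`-WL has another
form). -/
def LGraph.tupleColor {C : Type} (G : LGraph C) (k : ℕ) :
    (t : ℕ) → (Fin k → G.V) → TupleColor C k t
  | 0 => fun v => G.isoType v
  | t + 1 => fun v =>
      (G.tupleColor k t v,
        fun i => (Finset.univ : Finset G.V).val.map
          (fun u => G.tupleColor k t (Function.update v i u)))

/-- The color `c_k^t(G)` of the whole graph: the multiset of the colors of all `k`-tuples. -/
def LGraph.wlColor {C : Type} (G : LGraph C) (k t : ℕ) : Multiset (TupleColor C k t) :=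
  (Finset.univ : Finset (Fin k → G.V)).val.map (fun v => G.tupleColor k t v)

/-- The color `c_{k,l}^t(G)`: the multiset of the `k`-WL colors of all labeled graphs `G^v`,
where `v` runs over all `l`-tuples of nodes. -/
def LGraph.klColor {C : Type} (G : LGraph C) (k l t : ℕ) :
    Multiset (Multiset (TupleColor (C × Set (Fin l)) k t)) :=
  (Finset.univ : Finset (Fin l → G.V)).val.map (fun v => (G.label v).wlColor k t)

/-- An algorithm that assigns to every graph a (final) color. -/
structure GraphAlgorithm where
  Color : Type → Type
  color : {C : Type} → LGraph C → Color C

/-- `k,l`-WL. The final color is the whole history of colors of the graph. By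
`LGraph.klWL_color_eq_iff_of_stable` below, two graphs have equal final colors iff their colors
agree at an iteration at which the tuple colors are stable on the two graphs. -/
def klWL (k l : ℕ) : GraphAlgorithm where
  Color := fun C => (t : ℕ) → Multiset (Multiset (TupleColor (C × Set (Fin l)) k t))
  color := fun G t => G.klColor k l t

namespace GraphAlgorithm

/-- `B ⪯ A`: every pair of graphs that `A` does not distinguish is not distinguished by `B`. -/
def LessEq (B A : GraphAlgorithm) : Prop :=
  ∀ (C : Type) (G H : LGraph C), A.color G = A.color H → B.color G = B.color H

/-- `A ≅ B`. -/
def AsPowerful (A B : GraphAlgorithm) : Prop := LessEq B A ∧ LessEq A B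

/-- `B ≺ A`. -/
def Less (B A : GraphAlgorithm) : Prop := LessEq B A ∧ ¬ AsPowerful A B

/-- `A` distinguishes `G` and `H`. -/
def Distinguishes (A : GraphAlgorithm) {C : Type} (G H : LGraph C) : Prop :=
  A.color G ≠ A.color H

end GraphAlgorithm

/-! ### Stable colors -/

namespace LGraph

variable {C : Type}

/-- The colors of all `k`-tuples in all labeled graphs that arise from `G` or from `H`. -/
def jointColor (G H : LGraph C) (k l t : ℕ) :
    ((Fin l → G.V) × (Fin k → G.V)) ⊕ ((Fin l → H.V) × (Fin k → H.V)) →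
      TupleColor (C × Set (Fin l)) k t :=
  Sum.elim (fun p => (G.label p.1).tupleColor k t p.2) (fun p => (H.label p.1).tupleColor k t p.2)

/-- The tuple colors on `G` and `H` are stable at iteration `t`. -/
def IsStable (G H : LGraph C) (k l t : ℕ) : Prop :=
  ∀ x y, G.jointColor H k l t x = G.jointColor H k l t y ↔
    G.jointColor H k l (t + 1) x = G.jointColor H k l (t + 1) y

lemma klColor_eq_of_factor (G H : LGraph C) (k l s t : ℕ)
    (f : TupleColor (C × Set (Fin l)) k s → TupleColor (C × Set (Fin l)) k t)
    (hf : ∀ x, G.jointColor H k l t x = f (G.jointColor H k l s x))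
    (h : G.klColor k l s = H.klColor k l s) : G.klColor k l t = H.klColor k l t := by
  have h1 : G.klColor k l t = (G.klColor k l s).map (Multiset.map f) := by
    simp only [klColor, wlColor, Multiset.map_map, Function.comp_def]
    refine Multiset.map_congr rfl fun v _ => Multiset.map_congr rfl fun u _ => ?_
    exact hf (Sum.inl (v, u))
  have h2 : H.klColor k l t = (H.klColor k l s).map (Multiset.map f) := by
    simp only [klColor, wlColor, Multiset.map_map, Function.comp_def]
    refine Multiset.map_congr rfl fun v _ => Multiset.map_congr rfl fun u _ => ?_
    exact hf (Sum.inr (v, u))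
  rw [h1, h2, h]

def TupleColor.next {C : Type} {k : ℕ} (s : ℕ) : (t : ℕ) → TupleColor C k s → TupleColor C k t
  | 0, c => Nat.rec (motive := fun s => TupleColor C k s → IsoType C k)
      (fun c => c) (fun _ ih c => ih c.1) s c
  | t + 1, c => (TupleColor.next s t c, fun _ => 0)

lemma klColor_eq_of_refines (G H : LGraph C) (k l s t : ℕ)
    (hst : ∀ x y, G.jointColor H k l s x = G.jointColor H k l s y →
      G.jointColor H k l t x = G.jointColor H k l t y)
    (h : G.klColor k l s = H.klColor k l s) : G.klColor k l t = H.klColor k l t := by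
  obtain ⟨f, hf⟩ : ∃ f : TupleColor (C × Set (Fin l)) k s → TupleColor (C × Set (Fin l)) k t,
      ∀ x, G.jointColor H k l t x = f (G.jointColor H k l s x) := by
    have hF : Function.FactorsThrough (G.jointColor H k l t) (G.jointColor H k l s) :=
      fun x y hxy => hst x y hxy
    exact ⟨Function.extend (G.jointColor H k l s) (G.jointColor H k l t) (TupleColor.next s t),
      fun x => (hF.extend_apply _ x).symm⟩
  exact klColor_eq_of_factor G H k l s t f hf h

lemma jointColor_of_succ (G H : LGraph C) (k l t : ℕ) (x y)
    (h : G.jointColor H k l (t + 1) x = G.jointColor H k l (t + 1) y) :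
    G.jointColor H k l t x = G.jointColor H k l t y := by
  have h1 := congrArg Prod.fst h
  rcases x with x | x <;> rcases y with y | y <;> exact h1

lemma jointColor_of_le (G H : LGraph C) (k l : ℕ) {s t : ℕ} (hst : s ≤ t) (x y)
    (h : G.jointColor H k l t x = G.jointColor H k l t y) :
    G.jointColor H k l s x = G.jointColor H k l s y := by
  induction t, hst using Nat.le_induction with
  | base => exact h
  | succ n _ ih => exact ih (jointColor_of_succ G H k l n x y h)

lemma IsStable.succ {G H : LGraph C} {k l t : ℕ} (hs : G.IsStable H k l t) :
    G.IsStable H k l (t + 1) := by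
  intro x y
  refine ⟨fun h => ?_, jointColor_of_succ G H k l (t + 1) x y⟩
  have hF : Function.FactorsThrough (G.jointColor H k l (t + 1)) (G.jointColor H k l t) :=
    fun x y hxy => (hs x y).1 hxy
  obtain ⟨f, hf⟩ : ∃ f : TupleColor (C × Set (Fin l)) k t → TupleColor (C × Set (Fin l)) k (t + 1),
      ∀ x, G.jointColor H k l (t + 1) x = f (G.jointColor H k l t x) :=
    ⟨Function.extend (G.jointColor H k l t) (G.jointColor H k l (t + 1)) (TupleColor.next t _),
      fun x => (hF.extend_apply _ x).symm⟩
  have hG : ∀ (p : Fin l → G.V) (v : Fin k → G.V),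
      (G.label p).tupleColor k (t + 1) v = f ((G.label p).tupleColor k t v) :=
    fun p v => hf (Sum.inl (p, v))
  have hH : ∀ (p : Fin l → H.V) (v : Fin k → H.V),
      (H.label p).tupleColor k (t + 1) v = f ((H.label p).tupleColor k t v) :=
    fun p v => hf (Sum.inr (p, v))
  have key : ∀ x, G.jointColor H k l (t + 2) x =
      (G.jointColor H k l (t + 1) x,
        fun i => Multiset.map f ((G.jointColor H k l (t + 1) x).2 i)) := by
    rintro (⟨p, v⟩ | ⟨p, v⟩)
    · refine Prod.ext rfl (funext fun i => ?_)
      change Multiset.map _ _ = Multiset.map f (Multiset.map _ _)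
      rw [Multiset.map_map]
      exact Multiset.map_congr rfl fun u _ => hG p _
    · refine Prod.ext rfl (funext fun i => ?_)
      change Multiset.map _ _ = Multiset.map f (Multiset.map _ _)
      rw [Multiset.map_map]
      exact Multiset.map_congr rfl fun u _ => hH p _
  rw [key x, key y, h]

/-- The final colors of two graphs are equal iff their colors at a stable iteration are. -/
theorem klWL_color_eq_iff_of_stable (G H : LGraph C) (k l t : ℕ) (hs : G.IsStable H k l t) :
    (klWL k l).color G = (klWL k l).color H ↔ G.klColor k l t = H.klColor k l t := by
  refine ⟨fun h => congrFun h t, fun h => funext fun s => ?_⟩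
  rcases le_total s t with hst | hst
  · exact klColor_eq_of_refines G H k l t s (fun x y => jointColor_of_le G H k l hst x y) h
  · have : G.IsStable H k l s ∧ G.klColor k l s = H.klColor k l s := by
      induction s, hst using Nat.le_induction with
      | base => exact ⟨hs, h⟩
      | succ n _ ih =>
        exact ⟨ih.1.succ, klColor_eq_of_refines G H k l n (n + 1)
          (fun x y => (ih.1 x y).1) ih.2⟩
    exact this.2

end LGraph

/-! ### CFI-type graphs

The base graph `B` has pairwise differently colored nodes: the feature of `v` is `v` itself.
The bits of the block of `v` are indexed by the neighbors of `v`, and a binary string is given by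
the set `S` of the neighbors at which its bit is `1`. -/

section CFI

variable {V : Type}

/-- The strings of the blocks, `(v, S)` with `S` a set of neighbors of `v`, that satisfy `P`. -/
abbrev BinNode (B : SimpleGraph V) (P : Finset V → Prop) : Type :=
  {p : V × Finset V // (∀ w ∈ p.2, B.Adj p.1 w) ∧ P p.2}

/-- The bit nodes: `((v, w), false)` is `a(v, w)` and `((v, w), true)` is `b(v, w)`. -/
abbrev BitNode (B : SimpleGraph V) : Type := {p : V × V // B.Adj p.1 p.2} × Bool

abbrev BlockNode (B : SimpleGraph V) (P : Finset V → Prop) : Type := BinNode B P ⊕ BitNode B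

/-- Each string `(v, S)` is joined to its bits, and the bit nodes of an edge `vw` are joined
straight if `vw ∉ T` and crosswise if `vw ∈ T`. -/
def blockRel (B : SimpleGraph V) (P : Finset V → Prop) (T : Set (Sym2 V)) :
    BlockNode B P → BlockNode B P → Prop
  | .inl p, .inr q => p.1.1 = q.1.1.1 ∧ (q.2 = true ↔ q.1.1.2 ∈ p.1.2)
  | .inr q, .inr r =>
      q.1.1.1 = r.1.1.2 ∧ q.1.1.2 = r.1.1.1 ∧ (q.2 = r.2 ↔ s(q.1.1.1, q.1.1.2) ∉ T)
  | _, _ => False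

def blockGraph (B : SimpleGraph V) (P : Finset V → Prop) (T : Set (Sym2 V)) :
    SimpleGraph (BlockNode B P) :=
  SimpleGraph.fromRel (blockRel B P T)

/-- The strings of the block of `v` have color `(v, none)`, the bit nodes `a(v, w)` and `b(v, w)`
have color `(v, some w)`. -/
def blockColor (B : SimpleGraph V) (P : Finset V → Prop) : BlockNode B P → V × Option V
  | .inl p => (p.1.1, none)
  | .inr q => (q.1.1.1, some q.1.1.2)

/-- Strings with an even number of ones. -/
abbrev EvenCard (S : Finset V) : Prop := Even S.card

open Classical in
/-- The CFI graph `χ(B)` with the edges in `T` twisted. -/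
noncomputable def chi [Fintype V] (B : SimpleGraph V) (T : Set (Sym2 V)) :
    LGraph (V × Option V) where
  V := BlockNode B EvenCard
  graph := blockGraph B EvenCard T
  X := blockColor B EvenCard

/-- The nodes of the branches: `χ` over the complete graph on `a + 1` nodes. -/
abbrev BranchNode (a : ℕ) : Type := BlockNode (⊤ : SimpleGraph (Fin (a + 1))) EvenCard

/-- Nodes of `γ_a(B)`: strings (of either parity), bits, and one branch for every string. -/
abbrev GammaNode (a : ℕ) (B : SimpleGraph V) : Type :=
  BlockNode B (fun _ => True) ⊕ (BinNode B (fun _ => True) × BranchNode a)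

open Classical in
/-- The branch of an even string is `χ(K_{a+1})` with the edge `e` twisted, and the branch of an
odd string is `χ(K_{a+1})`; each string is joined to all nodes of its branch. -/
noncomputable def gammaRel (a : ℕ) (e : Sym2 (Fin (a + 1))) (B : SimpleGraph V)
    (T : Set (Sym2 V)) : GammaNode a B → GammaNode a B → Prop
  | .inl x, .inl y => (blockGraph B (fun _ => True) T).Adj x y
  | .inl (.inl p), .inr q => p = q.1
  | .inr q, .inr r => q.1 = r.1 ∧
      (chi (⊤ : SimpleGraph (Fin (a + 1))) (if Even q.1.1.2.card then {e} else ∅)).graph.Adj q.2 r.2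
  | _, _ => False

/-- A block node keeps its color; a branch node in the block of `v` gets the color `v`, the mark
`inr` and its color in the branch. In particular, even and odd strings of a block have the same
color. -/
def gammaColor (a : ℕ) (B : SimpleGraph V) :
    GammaNode a B → V × (Option V ⊕ (Fin (a + 1) × Option (Fin (a + 1))))
  | .inl x => ((blockColor B _ x).1, .inl (blockColor B _ x).2)
  | .inr q => (q.1.1.1, .inr (blockColor _ _ q.2))

open Classical in
/-- The graph `γ_a(B)` with the edges in `T` twisted, where the twisted branches are twisted at
the edge `e` of `K_{a+1}`. -/
noncomputable def gamma [Fintype V] (a : ℕ) (e : Sym2 (Fin (a + 1))) (B : SimpleGraph V)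
    (T : Set (Sym2 V)) :
    LGraph (V × (Option V ⊕ (Fin (a + 1) × Option (Fin (a + 1))))) where
  V := GammaNode a B
  graph := SimpleGraph.fromRel (gammaRel a e B T)
  X := gammaColor a B

end CFI

/-! ### Multisets of values and matching bijections -/

/-! Equal colors mean that the duplicator survives in the bijective pebble game. A pebble that is
never moved is as good as a label, so `k + 1` pebbles and `l` labels simulate `k` pebbles and `l +
1` labels (`klWL_lessEq_succ`).

For the separation, call a simultaneous exchange of bits in the blocks a flip. In `χ` a flip has to
preserve the parity of strings; it can push a single twist around but not remove it. With `k`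
pebbles on `k + 1` blocks, the defect can always be kept at a pebble-free block, so `k` pebbles do
not separate `G_k` from `H_k` (`backForth_chiRel`). In `γ` strings of both parities occur, and a
flip removes the twist altogether at the price of changing parities in one block `c` of free choice
(`exists_flip_singleton`). The change shows only in the branches over `c`, where `G_k` and `H_k` are
exchanged. The `l + 1` labels miss one of the `k + l + 1` blocks; with that block as `c`, the
branches over `c` contain pebbles only, and `k` of them see no difference
(`wlColor_gamma_label_eq`).

Conversely, `k + 1` pebbles, one in each block of a branch, tell the two kinds of branch apart, so
they read off the parity of a string (`not_even_of_equi`). Now `l` labels and `k + 1` pebbles mark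
the empty string in each of the `k + l + 1` blocks. The replies in the twisted graph are even
strings whose bits agree across every edge except `f`, which the handshake lemma forbids
(`exists_not_even_card`). The same count, inside a branch, separates `G_k` from `H_k`. -/

lemma exists_equiv_of_map_univ_eq {α β γ : Type*} [Fintype α] [Fintype β] {a : α → γ} {b : β → γ}
    (h : (Finset.univ : Finset α).val.map a = (Finset.univ : Finset β).val.map b) :
    ∃ e : α ≃ β, ∀ x, a x = b (e x) := by
  classical
  have hc : ∀ c, Fintype.card {x // a x = c} = Fintype.card {y // b y = c} := by
    intro c
    have := congrArg (Multiset.count c) h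
    rw [Multiset.count_map, Multiset.count_map] at this
    rw [Fintype.card_subtype, Fintype.card_subtype]
    simpa [Finset.card, Finset.filter_val, eq_comm] using this
  refine ⟨Equiv.ofFiberEquiv fun c => Fintype.equivOfCardEq (hc c), fun x => ?_⟩
  exact (Equiv.ofFiberEquiv_map _ x).symm

lemma map_univ_eq_of_equiv {α β γ : Type*} [Fintype α] [Fintype β] {a : α → γ} {b : β → γ}
    (e : α ≃ β) (h : ∀ x, a x = b (e x)) :
    (Finset.univ : Finset α).val.map a = (Finset.univ : Finset β).val.map b := by
  rw [← Multiset.map_univ_val_equiv e, Multiset.map_map]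
  exact Multiset.map_congr rfl fun x _ => h x

/-- The admissible sets shrink with `t` inside a finite type, so they share a point. This turns
replies that depend on the number of rounds into one reply that is good forever. -/
lemma exists_forall_of_antitone {α : Type*} [Finite α] {P : ℕ → α → Prop}
    (hP : ∀ t x, P (t + 1) x → P t x) (h : ∀ t, ∃ x, P t x) : ∃ x, ∀ t, P t x := by
  by_contra! hne
  choose m hm using hne
  have hle : ∀ s t x, s ≤ t → P t x → P s x := fun s t x hst =>
    Nat.le_induction (P := fun t _ => P t x → P s x) id (fun n _ ih hn => ih (hP n x hn)) t hst
  obtain ⟨M, hM⟩ := (Set.finite_range m).bddAbove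
  obtain ⟨x, hx⟩ := h M
  exact hm x (hle _ _ _ (hM ⟨x, rfl⟩) hx)

namespace LGraph

variable {C : Type} {G H : LGraph C} {k : ℕ}

/-! ### Comparing tuple colors in two graphs -/

lemma tupleColor_succ_eq_iff {t : ℕ} {v : Fin k → G.V} {v' : Fin k → H.V} :
    G.tupleColor k (t + 1) v = H.tupleColor k (t + 1) v' ↔
      G.tupleColor k t v = H.tupleColor k t v' ∧
      ∀ i, ∃ f : G.V ≃ H.V, ∀ w,
        G.tupleColor k t (Function.update v i w) =
          H.tupleColor k t (Function.update v' i (f w)) := by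
  constructor
  · intro h
    refine ⟨congrArg Prod.fst h, fun i => ?_⟩
    exact exists_equiv_of_map_univ_eq (congrFun (congrArg Prod.snd h) i)
  · rintro ⟨h, hi⟩
    refine Prod.ext h (funext fun i => ?_)
    obtain ⟨f, hf⟩ := hi i
    exact map_univ_eq_of_equiv f hf

lemma tupleColor_eq_of_le {s t : ℕ} (hst : s ≤ t) {v : Fin k → G.V} {v' : Fin k → H.V}
    (h : G.tupleColor k t v = H.tupleColor k t v') :
    G.tupleColor k s v = H.tupleColor k s v' := by
  induction t, hst using Nat.le_induction with
  | base => exact h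
  | succ n _ ih => exact ih (tupleColor_succ_eq_iff.1 h).1

lemma isoType_eq_of_tupleColor_eq {t : ℕ} {v : Fin k → G.V} {v' : Fin k → H.V}
    (h : G.tupleColor k t v = H.tupleColor k t v') : G.isoType v = H.isoType v' :=
  tupleColor_eq_of_le (Nat.zero_le t) h

lemma isoType_eq_iff {v : Fin k → G.V} {v' : Fin k → H.V} :
    G.isoType v = H.isoType v' ↔
      (∀ i j, v i = v j ↔ v' i = v' j) ∧ (∀ i, G.X (v i) = H.X (v' i)) ∧
      ∀ i j, G.graph.Adj (v i) (v j) ↔ H.graph.Adj (v' i) (v' j) := by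
  simp [isoType, Prod.ext_iff, funext_iff]

lemma wlColor_eq_iff {t : ℕ} :
    G.wlColor k t = H.wlColor k t ↔ ∃ e : (Fin k → G.V) ≃ (Fin k → H.V),
      ∀ v, G.tupleColor k t v = H.tupleColor k t (e v) := by
  classical
  exact ⟨exists_equiv_of_map_univ_eq, fun ⟨e, he⟩ => map_univ_eq_of_equiv e he⟩

lemma klColor_eq_iff {l t : ℕ} :
    G.klColor k l t = H.klColor k l t ↔ ∃ e : (Fin l → G.V) ≃ (Fin l → H.V),
      ∀ u, (G.label u).wlColor k t = (H.label (e u)).wlColor k t := by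
  classical
  exact ⟨exists_equiv_of_map_univ_eq, fun ⟨e, he⟩ => map_univ_eq_of_equiv e he⟩

/-- The tuple `v` with its first `m` entries replaced by `x`. -/
def overwrite {α : Type*} {k m : ℕ} (v : Fin k → α) (x : Fin m → α) : Fin k → α :=
  fun i => if h : (i : ℕ) < m then x ⟨i, h⟩ else v i

lemma overwrite_snoc {α : Type*} {k m : ℕ} (hm : m < k) (v : Fin k → α) (x : Fin m → α) (w : α) :
    overwrite v (Fin.snoc x w : Fin (m + 1) → α) =
      overwrite (Function.update v ⟨m, hm⟩ w) x := by
  funext i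
  rcases lt_trichotomy (i : ℕ) m with h | h | h
  · simp [overwrite, h, h.trans (Nat.lt_succ_self m), Fin.snoc]
  · obtain rfl : i = ⟨m, hm⟩ := Fin.ext h
    simp [overwrite, Fin.snoc]
  · have h1 : ¬ (i : ℕ) < m + 1 := by omega
    have h2 : i ≠ ⟨m, hm⟩ := fun h' => by simp [h'] at h
    simp [overwrite, h1, h.not_gt, h2]

lemma overwrite_of_isEmpty {α : Type*} {k : ℕ} (v : Fin k → α) (x : Fin 0 → α) :
    overwrite v x = v := by
  funext i; simp [overwrite]

lemma overwrite_self {α : Type*} {k : ℕ} (v x : Fin k → α) : overwrite v x = x := by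
  funext i; simp [overwrite]

lemma overwrite_eq_snoc {α : Type*} {k : ℕ} (v : Fin (k + 1) → α) (x : Fin k → α) :
    overwrite v x = Fin.snoc x (v (Fin.last k)) := by
  funext i
  refine Fin.lastCases ?_ (fun j => ?_) i <;> simp [overwrite]

/-- Every overwritten entry costs one round. Entry `m` is replaced first, and the bijection for the
earlier entries may depend on the value chosen there, hence the sheared product. -/
lemma exists_equiv_overwrite {m : ℕ} (hm : m ≤ k) (t : ℕ) {v : Fin k → G.V} {v' : Fin k → H.V}
    (h : G.tupleColor k (t + m) v = H.tupleColor k (t + m) v') :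
    ∃ e : (Fin m → G.V) ≃ (Fin m → H.V), ∀ x,
      G.tupleColor k t (overwrite v x) = H.tupleColor k t (overwrite v' (e x)) := by
  induction m generalizing v v' with
  | zero =>
    refine ⟨Equiv.ofUnique _ _, fun x => ?_⟩
    rw [overwrite_of_isEmpty, overwrite_of_isEmpty]
    exact h
  | succ m ih =>
    obtain ⟨f, hf⟩ := (tupleColor_succ_eq_iff (t := t + m).1 h).2 ⟨m, hm⟩
    choose e he using fun w => ih (Nat.le_of_succ_le hm) (hf w)
    refine ⟨(Fin.snocEquiv fun _ => G.V).symm.trans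
      ((Equiv.prodShear f e).trans (Fin.snocEquiv fun _ => H.V)), fun x => ?_⟩
    obtain ⟨⟨w, x⟩, rfl⟩ := (Fin.snocEquiv fun _ => G.V).surjective x
    simp only [Equiv.trans_apply, Equiv.symm_apply_apply]
    change G.tupleColor k t (overwrite v (Fin.snoc x w : Fin (m + 1) → G.V)) =
      H.tupleColor k t (overwrite v' (Fin.snoc (e w x) (f w) : Fin (m + 1) → H.V))
    rw [overwrite_snoc hm, overwrite_snoc hm]
    exact he w x

/-- Overwriting all `k` entries reaches every tuple, so a single matching pair settles the whole
graph, `k` rounds earlier. -/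
lemma wlColor_eq_of_tupleColor_eq {t : ℕ} {v : Fin k → G.V} {v' : Fin k → H.V}
    (h : G.tupleColor k (t + k) v = H.tupleColor k (t + k) v') :
    G.wlColor k t = H.wlColor k t := by
  obtain ⟨e, he⟩ := exists_equiv_overwrite le_rfl t h
  exact wlColor_eq_iff.2 ⟨e, fun x => by simpa only [overwrite_self] using he x⟩

/-- A winning strategy of the duplicator in the bijective `k`-pebble game. -/
structure BackForth (G H : LGraph C) (k : ℕ) (R : (Fin k → G.V) → (Fin k → H.V) → Prop) :
    Prop where
  iso : ∀ v v', R v v' → G.isoType v = H.isoType v'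
  step : ∀ v v', R v v' → ∀ i, ∃ f : G.V ≃ H.V, ∀ w,
    R (Function.update v i w) (Function.update v' i (f w))

lemma BackForth.tupleColor_eq {R : (Fin k → G.V) → (Fin k → H.V) → Prop}
    (hR : BackForth G H k R) (t : ℕ) {v : Fin k → G.V} {v' : Fin k → H.V} (h : R v v') :
    G.tupleColor k t v = H.tupleColor k t v' := by
  induction t generalizing v v' with
  | zero => exact hR.iso v v' h
  | succ t ih =>
    refine tupleColor_succ_eq_iff.2 ⟨ih h, fun i => ?_⟩
    obtain ⟨f, hf⟩ := hR.step v v' h i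
    exact ⟨f, fun w => ih (hf w)⟩

lemma BackForth.wlColor_eq {R : (Fin k → G.V) → (Fin k → H.V) → Prop}
    (hR : BackForth G H k R) (t : ℕ) {v : Fin k → G.V} {v' : Fin k → H.V} (h : R v v') :
    G.wlColor k t = H.wlColor k t :=
  wlColor_eq_of_tupleColor_eq (hR.tupleColor_eq (t + k) h)

lemma backForth_eq (G : LGraph C) (k : ℕ) : BackForth G G k (· = ·) where
  iso := by rintro v _ rfl; rfl
  step := by rintro v _ rfl i; exact ⟨Equiv.refl _, fun _ => rfl⟩

/-! ### Trading a label for a pebble -/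

lemma label_X_snoc_eq {l : ℕ} {u : Fin l → G.V} {u' : Fin l → H.V} {w x : G.V} {w' x' : H.V}
    (hX : (G.label u).X x = (H.label u').X x') (hw : x = w ↔ x' = w') :
    (G.label (Fin.snoc u w : Fin (l + 1) → G.V)).X x =
      (H.label (Fin.snoc u' w' : Fin (l + 1) → H.V)).X x' := by
  obtain ⟨h1, h2⟩ := Prod.ext_iff.1 hX
  refine Prod.ext h1 (Set.ext fun i => ?_)
  refine Fin.lastCases ?_ (fun j => ?_) i
  · simpa [label, eq_comm] using hw
  · simpa [label] using Set.ext_iff.1 h2 j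

/-- The last pebble is never moved, and the equality pattern with it says which entries would carry
the new label. -/
lemma tupleColor_label_snoc_eq {l : ℕ} {u : Fin l → G.V} {u' : Fin l → H.V} {w : G.V} {w' : H.V}
    (t : ℕ) {x : Fin k → G.V} {x' : Fin k → H.V}
    (h : (G.label u).tupleColor (k + 1) t (Fin.snoc x w : Fin (k + 1) → G.V) =
      (H.label u').tupleColor (k + 1) t (Fin.snoc x' w' : Fin (k + 1) → H.V)) :
    (G.label (Fin.snoc u w : Fin (l + 1) → G.V)).tupleColor k t x =
      (H.label (Fin.snoc u' w' : Fin (l + 1) → H.V)).tupleColor k t x' := by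
  induction t generalizing x x' with
  | zero =>
    obtain ⟨h1, h2, h3⟩ := (isoType_eq_iff (G := G.label u) (H := H.label u')).1 h
    have e : ∀ i, (Fin.snoc x w : Fin (k + 1) → G.V) i.castSucc = x i := fun i => by simp
    have e' : ∀ i, (Fin.snoc x' w' : Fin (k + 1) → H.V) i.castSucc = x' i := fun i => by simp
    have el : (Fin.snoc x w : Fin (k + 1) → G.V) (Fin.last k) = w := by simp
    have el' : (Fin.snoc x' w' : Fin (k + 1) → H.V) (Fin.last k) = w' := by simp
    refine isoType_eq_iff.2 ⟨fun i j => ?_, fun i => label_X_snoc_eq ?_ ?_, fun i j => ?_⟩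
    · rw [← e i, ← e j, ← e' i, ← e' j]; exact h1 i.castSucc j.castSucc
    · rw [← e i, ← e' i]; exact h2 i.castSucc
    · have := h1 i.castSucc (Fin.last k)
      rwa [e, e', el, el'] at this
    · rw [← e i, ← e j, ← e' i, ← e' j]; exact h3 i.castSucc j.castSucc
  | succ t ih =>
    obtain ⟨h1, h2⟩ := tupleColor_succ_eq_iff.1 h
    refine tupleColor_succ_eq_iff.2 ⟨ih h1, fun i => ?_⟩
    obtain ⟨f, hf⟩ := h2 i.castSucc
    refine ⟨f, fun y => ih ?_⟩
    have e1 := Fin.snoc_update (α := fun _ => G.V) w x i y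
    have e2 := Fin.snoc_update (α := fun _ => H.V) w' x' i (f y)
    exact (congrArg _ e1).trans ((hf y).trans (congrArg _ e2.symm))

/-- Constant tuples are recognized by their equality pattern, so a color-preserving bijection of
tuples restricts to them. -/
lemma exists_equiv_const {t : ℕ} (h : G.wlColor (k + 1) t = H.wlColor (k + 1) t) :
    ∃ f : G.V ≃ H.V, ∀ w,
      G.tupleColor (k + 1) t (fun _ => w) = H.tupleColor (k + 1) t (fun _ => f w) := by
  obtain ⟨e, he⟩ := wlColor_eq_iff.1 h
  have h1 : ∀ w, e (fun _ => w) = fun _ => e (fun _ => w) 0 := fun w => funext fun i =>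
    ((isoType_eq_iff.1 (isoType_eq_of_tupleColor_eq (he fun _ => w))).1 i 0).1 rfl
  have h2 : ∀ w, e.symm (fun _ => w) = fun _ => e.symm (fun _ => w) 0 := fun w => funext fun i =>
    ((isoType_eq_iff.1 (isoType_eq_of_tupleColor_eq (he (e.symm fun _ => w)))).1 i 0).2 (by simp)
  refine ⟨⟨fun w => e (fun _ => w) 0, fun w => e.symm (fun _ => w) 0, fun w => ?_, fun w => ?_⟩,
    fun w => ?_⟩
  · simp only [← h1, Equiv.symm_apply_apply]
  · simp only [← h2, Equiv.apply_symm_apply]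
  · rw [he, h1]; rfl

end LGraph

open LGraph in
-- The extra label `w` is simulated from the constant tuple at `w`: its last entry stays, while the
-- other `k` entries are overwritten, which uses up the `k` extra iterations. The reply to `w` may
-- depend on the other labels.
theorem klWL_lessEq_succ (k l : ℕ) : (klWL k (l + 1)).LessEq (klWL (k + 1) l) := by
  intro C G H h
  funext t
  obtain ⟨e, he⟩ := klColor_eq_iff.1 (congrFun h (t + k))
  choose f hf using fun u => exists_equiv_const (he u)
  refine klColor_eq_iff.2 ⟨(Fin.snocEquiv fun _ => G.V).symm.trans
    (((Equiv.prodComm _ _).trans ((Equiv.prodShear e f).trans (Equiv.prodComm _ _))).trans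
      (Fin.snocEquiv fun _ => H.V)), fun u => ?_⟩
  obtain ⟨⟨w, u⟩, rfl⟩ := (Fin.snocEquiv fun _ => G.V).surjective u
  simp only [Equiv.trans_apply, Equiv.symm_apply_apply]
  change (G.label (Fin.snoc u w : Fin (l + 1) → G.V)).wlColor k t =
    (H.label (Fin.snoc (e u) (f u w) : Fin (l + 1) → H.V)).wlColor k t
  obtain ⟨e', he'⟩ := exists_equiv_overwrite (Nat.le_succ k) t (hf u w)
  refine wlColor_eq_iff.2 ⟨e', fun x => tupleColor_label_snoc_eq t ?_⟩
  have h1 := overwrite_eq_snoc (fun _ => w) x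
  have h2 := overwrite_eq_snoc (fun _ => f u w) (e' x)
  exact (congrArg _ h1.symm).trans ((he' x).trans (congrArg _ h2))

namespace LGraph

variable {C : Type} {G H : LGraph C} {k : ℕ}

/-! ### Tuples that are never told apart -/

/-- The tuples `v` and `v'` have the same color at every iteration. -/
def Equi (G H : LGraph C) (k : ℕ) (v : Fin k → G.V) (v' : Fin k → H.V) : Prop :=
  ∀ t, G.tupleColor k t v = H.tupleColor k t v'

namespace Equi

variable {v : Fin k → G.V} {v' : Fin k → H.V}

lemma symm (h : Equi G H k v v') : Equi H G k v' v := fun t => (h t).symm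

lemma X_eq (h : Equi G H k v v') (i) : H.X (v' i) = G.X (v i) :=
  ((isoType_eq_iff.1 (h 0)).2.1 i).symm

lemma adj (h : Equi G H k v v') {i j} (hij : G.graph.Adj (v i) (v j)) :
    H.graph.Adj (v' i) (v' j) :=
  ((isoType_eq_iff.1 (h 0)).2.2 i j).1 hij

lemma forth (h : Equi G H k v v') (i : Fin k) (w : G.V) :
    ∃ w', Equi G H k (Function.update v i w) (Function.update v' i w') := by
  refine exists_forall_of_antitone (fun t x hx => (tupleColor_succ_eq_iff.1 hx).1) fun t => ?_
  obtain ⟨f, hf⟩ := (tupleColor_succ_eq_iff.1 (h (t + 1))).2 i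
  exact ⟨f w, hf w⟩

lemma forth_finset (h : Equi G H k v v') (J : Finset (Fin k)) (z : Fin k → G.V) :
    ∃ z', Equi G H k (J.piecewise z v) z' ∧ ∀ i ∉ J, z' i = v' i := by
  induction J using Finset.induction_on with
  | empty => exact ⟨v', by simpa using h, fun _ _ => rfl⟩
  | insert j J _ ih =>
    obtain ⟨z', hz, hz'⟩ := ih
    obtain ⟨w', hw⟩ := hz.forth j (z j)
    refine ⟨Function.update z' j w', ?_, fun i hi => ?_⟩
    · rwa [Finset.piecewise_insert]
    · rw [Finset.mem_insert, not_or] at hi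
      rw [Function.update_of_ne hi.1, hz' i hi.2]

lemma exists_common_neighbor (h : Equi G H k v v') {i j m : Fin k} (hi : m ≠ i) (hj : m ≠ j)
    {a : G.V} (hia : G.graph.Adj (v i) a) (haj : G.graph.Adj a (v j)) :
    ∃ a', H.X a' = G.X a ∧ H.graph.Adj (v' i) a' ∧ H.graph.Adj a' (v' j) := by
  obtain ⟨a', ha⟩ := h.forth m a
  refine ⟨a', by simpa using ha.X_eq m, ?_, ?_⟩
  · simpa [hi.symm] using ha.adj (i := i) (j := m) (by simpa [hi.symm] using hia)
  · simpa [hj.symm] using ha.adj (i := m) (j := j) (by simpa [hj.symm] using haj)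

/-- Pebble `m` goes to `a`. Its adjacency to `v i` is then established, so pebble `i` is free to
move on to `b`; three pebbles suffice. -/
lemma exists_path (h : Equi G H k v v') {i j m : Fin k} (hi : m ≠ i) (hj : m ≠ j) (hij : i ≠ j)
    {a b : G.V} (hia : G.graph.Adj (v i) a) (hab : G.graph.Adj a b)
    (hbj : G.graph.Adj b (v j)) :
    ∃ a' b', H.X a' = G.X a ∧ H.X b' = G.X b ∧
      H.graph.Adj (v' i) a' ∧ H.graph.Adj a' b' ∧ H.graph.Adj b' (v' j) := by
  obtain ⟨a', ha⟩ := h.forth m a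
  obtain ⟨b', hb⟩ := ha.forth i b
  refine ⟨a', b', by simpa using ha.X_eq m, by simpa using hb.X_eq i, ?_, ?_, ?_⟩
  · simpa [hi.symm] using ha.adj (i := i) (j := m) (by simpa [hi.symm] using hia)
  · simpa [hi] using hb.adj (i := m) (j := i) (by simpa [hi] using hab)
  · simpa [hij.symm, hj.symm] using
      hb.adj (i := i) (j := j) (by simpa [hij.symm, hj.symm] using hbj)

end Equi

/-- A label sits on a single node on either side, so the reply to a pebble placed on it is forced.
-/
lemma Equi.forth_label {l : ℕ} {u : Fin l → G.V} {u' : Fin l → H.V}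
    {v : Fin k → G.V} {v' : Fin k → H.V} (h : Equi (G.label u) (H.label u') k v v')
    (i : Fin k) (a : Fin l) :
    Equi (G.label u) (H.label u') k (Function.update v i (u a)) (Function.update v' i (u' a)) := by
  obtain ⟨w', hw⟩ := h.forth i (u a)
  have h1 := Set.ext_iff.1 (congrArg Prod.snd (hw.X_eq i)) a
  have h2 : u' a = Function.update v' i w' i :=
    h1.2 (Function.update_self (β := fun _ => G.V) i (u a) v).symm
  rwa [show u' a = w' from h2.trans (Function.update_self (β := fun _ => H.V) i w' v')]

/-- Any two distinct pebbles or labels can be put on two distinct positions of the tuples. -/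
lemma Equi.exists_pair {l : ℕ} {u : Fin l → G.V} {u' : Fin l → H.V}
    {v : Fin k → G.V} {v' : Fin k → H.V} (h : Equi (G.label u) (H.label u') k v v')
    (hk : 2 ≤ k) {p q : Fin l ⊕ Fin k} (hpq : p ≠ q) :
    ∃ (i j : Fin k) (w : Fin k → G.V) (w' : Fin k → H.V), i ≠ j ∧
      Equi (G.label u) (H.label u') k w w' ∧
      w i = Sum.elim u v p ∧ w' i = Sum.elim u' v' p ∧
      w j = Sum.elim u v q ∧ w' j = Sum.elim u' v' q := by
  have : Nontrivial (Fin k) := Fin.nontrivial_iff_two_le.2 hk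
  have ne : ∀ {α : Type} {i j : Fin k} (_ : i ≠ j) (a : α) (f : Fin k → α),
      Function.update f j a i = f i := fun h a f => Function.update_of_ne h a f
  have self : ∀ {α : Type} {i : Fin k} (a : α) (f : Fin k → α),
      Function.update f i a i = a := fun a f => Function.update_self _ a f
  rcases p with a | i <;> rcases q with b | j
  · obtain ⟨i, j, hij⟩ := exists_pair_ne (Fin k)
    exact ⟨i, j, _, _, hij, (h.forth_label i a).forth_label j b,
      (ne hij _ _).trans (self _ _), (ne hij _ _).trans (self _ _), self _ _, self _ _⟩
  · obtain ⟨i, hij⟩ := exists_ne j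
    exact ⟨i, j, _, _, hij, h.forth_label i a, self _ _, self _ _, ne hij.symm _ _,
      ne hij.symm _ _⟩
  · obtain ⟨j, hij⟩ := exists_ne i
    exact ⟨i, j, _, _, hij.symm, h.forth_label j b, ne hij.symm _ _, ne hij.symm _ _, self _ _,
      self _ _⟩
  · exact ⟨i, j, v, v', fun hij => hpq (by rw [hij]), h, rfl, rfl, rfl, rfl⟩

lemma exists_equi_of_color_eq {l : ℕ} (h : (klWL k l).color G = (klWL k l).color H)
    (u : Fin l → G.V) (v : Fin k → G.V) :
    ∃ u' v', Equi (G.label u) (H.label u') k v v' := by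
  classical
  obtain ⟨⟨u', v'⟩, hx⟩ := exists_forall_of_antitone (α := (Fin l → H.V) × (Fin k → H.V))
    (P := fun t x => (G.label u).tupleColor k t v = (H.label x.1).tupleColor k t x.2)
    (fun t x hx => (tupleColor_succ_eq_iff.1 hx).1) fun t => by
      obtain ⟨e, he⟩ := klColor_eq_iff.1 (congrFun h t)
      obtain ⟨e', he'⟩ := wlColor_eq_iff.1 (he u)
      exact ⟨(e u, e' v), he' v⟩
  exact ⟨u', v', hx⟩

end LGraph

/-! ### Adjacency in the graphs built from blocks -/

section Blocks

variable {V : Type} {B : SimpleGraph V} {P : Finset V → Prop} {T : Set (Sym2 V)}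

lemma blockGraph_adj_inl_inr {p : BinNode B P} {q : BitNode B} :
    (blockGraph B P T).Adj (.inl p) (.inr q) ↔
      p.1.1 = q.1.1.1 ∧ (q.2 = true ↔ q.1.1.2 ∈ p.1.2) := by
  simp [blockGraph, SimpleGraph.fromRel_adj, blockRel]

lemma blockGraph_adj_inl_inl {p q : BinNode B P} :
    ¬ (blockGraph B P T).Adj (.inl p) (.inl q) := by
  simp [blockGraph, SimpleGraph.fromRel_adj, blockRel]

lemma blockGraph_adj_inr_inr {q r : BitNode B} :
    (blockGraph B P T).Adj (.inr q) (.inr r) ↔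
      q.1.1.1 = r.1.1.2 ∧ q.1.1.2 = r.1.1.1 ∧ (q.2 = r.2 ↔ s(q.1.1.1, q.1.1.2) ∉ T) := by
  obtain ⟨⟨⟨v, w⟩, hvw⟩, b⟩ := q
  obtain ⟨⟨⟨v', w'⟩, hvw'⟩, b'⟩ := r
  have hne : v ≠ w := hvw.ne
  simp only [blockGraph, SimpleGraph.fromRel_adj, blockRel]
  constructor
  · rintro ⟨-, h | ⟨h1, h2, h3⟩⟩
    · exact h
    · subst h1 h2
      exact ⟨rfl, rfl, by rw [eq_comm, h3, Sym2.eq_swap]⟩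
  · rintro ⟨h1, h2, h3⟩
    refine ⟨fun h => hne ?_, .inl ⟨h1, h2, h3⟩⟩
    have h4 : v = v' := congrArg (fun q : BlockNode B P => (blockColor B P q).1) h
    rw [h4, h2]

lemma blockColor_eq_none {x : BlockNode B P} {v : V} (h : blockColor B P x = (v, none)) :
    ∃ S hS, x = .inl ⟨(v, S), hS⟩ := by
  rcases x with ⟨⟨v', S⟩, hS⟩ | q
  · obtain rfl : v' = v := congrArg Prod.fst h
    exact ⟨S, hS, rfl⟩
  · exact absurd (congrArg Prod.snd h) (by simp [blockColor])

lemma blockColor_eq_some {x : BlockNode B P} {v w : V} (h : blockColor B P x = (v, some w)) :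
    ∃ hvw b, x = .inr (⟨(v, w), hvw⟩, b) := by
  rcases x with p | ⟨⟨⟨v', w'⟩, hvw⟩, b⟩
  · exact absurd (congrArg Prod.snd h) (by simp [blockColor])
  · obtain rfl : v' = v := congrArg Prod.fst h
    obtain rfl : w' = w := Option.some.inj (congrArg Prod.snd h)
    exact ⟨hvw, b, rfl⟩

/-! ### Flips -/

lemma Finset.even_card_symmDiff [DecidableEq V] (S S' : Finset V) :
    Even (symmDiff S S').card ↔ (Even S.card ↔ Even S'.card) := by
  have h1 : (symmDiff S S').card = (S \ S').card + (S' \ S).card := by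
    rw [symmDiff_def]
    exact Finset.card_union_of_disjoint disjoint_sdiff_sdiff
  have h2 := Finset.card_sdiff_add_card_inter S S'
  have h3 := Finset.card_sdiff_add_card_inter S' S
  rw [Finset.inter_comm] at h3
  rw [h1, ← h2, ← h3]
  simp only [Nat.even_add]
  tauto

variable [DecidableEq V]

/-- For every block, a set of positions at which its strings and bits are flipped. -/
structure BlockFlip (B : SimpleGraph V) (P : Finset V → Prop) where
  flips : V → Finset V
  adj : ∀ v, ∀ w ∈ flips v, B.Adj v w
  pres : ∀ v S, P S → P (symmDiff S (flips v))

namespace BlockFlip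

variable (g : BlockFlip B P)

def bin : Equiv.Perm (BinNode B P) :=
  Function.Involutive.toPerm
    (fun p => ⟨(p.1.1, symmDiff p.1.2 (g.flips p.1.1)), by
      refine ⟨fun w hw => ?_, g.pres _ _ p.2.2⟩
      rcases Finset.mem_symmDiff.1 hw with h | h
      · exact p.2.1 w h.1
      · exact g.adj _ w h.1⟩)
    (fun p => by simp [symmDiff_symmDiff_cancel_right])

def bit : Equiv.Perm (BitNode B) :=
  Function.Involutive.toPerm
    (fun q => (q.1, xor q.2 (decide (q.1.1.2 ∈ g.flips q.1.1.1))))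
    (fun q => by simp)

def perm : Equiv.Perm (BlockNode B P) := Equiv.sumCongr g.bin g.bit

@[simp] lemma bin_snd (p : BinNode B P) :
    (g.bin p).1.2 = symmDiff p.1.2 (g.flips p.1.1) := rfl

@[simp] lemma bin_bin (p : BinNode B P) : g.bin (g.bin p) = p := g.bin.symm_apply_apply p

@[simp] lemma bit_fst (q : BitNode B) : (g.bit q).1 = q.1 := rfl

lemma bit_snd (q : BitNode B) :
    (g.bit q).2 = xor q.2 (decide (q.1.1.2 ∈ g.flips q.1.1.1)) := rfl

@[simp] lemma bit_bit (q : BitNode B) : g.bit (g.bit q) = q := g.bit.symm_apply_apply q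

@[simp] lemma perm_inl (p : BinNode B P) : g.perm (.inl p) = .inl (g.bin p) := rfl

@[simp] lemma perm_inr (q : BitNode B) : g.perm (.inr q) = .inr (g.bit q) := rfl

@[simp] lemma perm_perm (x : BlockNode B P) : g.perm (g.perm x) = x := by
  rcases x with p | q <;> simp

@[simp] lemma blockColor_perm (x : BlockNode B P) :
    blockColor B P (g.perm x) = blockColor B P x := by
  rcases x with p | q <;> rfl

lemma perm_congr {g g' : BlockFlip B P} {x : BlockNode B P}
    (h : g.flips (blockColor B P x).1 = g'.flips (blockColor B P x).1) :
    g.perm x = g'.perm x := by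
  rcases x with p | q
  · exact congrArg Sum.inl (Subtype.ext (Prod.ext rfl (congrArg (symmDiff p.1.2) h)))
  · refine congrArg Sum.inr (Prod.ext rfl ?_)
    rw [bit_snd, bit_snd]
    change g.flips q.1.1.1 = g'.flips q.1.1.1 at h
    rw [h]

/-- The flip turns the edge `vw` as twisted by `T` into the edge as twisted by `T'`. -/
def Matches (T T' : Set (Sym2 V)) (v w : V) : Prop :=
  (w ∈ g.flips v ↔ v ∈ g.flips w) ↔ (s(v, w) ∈ T ↔ s(v, w) ∈ T')

/-- Edges between strings and bits survive any flip, since both ends change at the same positions.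
An edge between bits feels the flips at both of its ends, which is what `Matches` compares; it
always joins different blocks. -/
lemma adj_perm_iff {T T' : Set (Sym2 V)} {x y : BlockNode B P}
    (hm : (blockColor B P x).1 ≠ (blockColor B P y).1 →
      g.Matches T T' (blockColor B P x).1 (blockColor B P y).1) :
    (blockGraph B P T').Adj (g.perm x) (g.perm y) ↔ (blockGraph B P T).Adj x y := by
  have aux : ∀ (p : BinNode B P) (q : BitNode B),
      (blockGraph B P T').Adj (.inl (g.bin p)) (.inr (g.bit q)) ↔
        (blockGraph B P T).Adj (.inl p) (.inr q) := by
    rintro ⟨⟨v, S⟩, hS⟩ ⟨⟨⟨v', w⟩, hvw⟩, b⟩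
    rw [blockGraph_adj_inl_inr, blockGraph_adj_inl_inr]
    refine and_congr_right fun h => ?_
    obtain rfl : v = v' := h
    simp only [bin_snd, bit_fst, bit_snd, Finset.mem_symmDiff]
    by_cases h1 : w ∈ g.flips v <;> by_cases h2 : w ∈ S <;> cases b <;> simp [h1, h2]
  rcases x with p | q <;> rcases y with p' | q'
  · exact iff_of_false blockGraph_adj_inl_inl blockGraph_adj_inl_inl
  · exact aux p q'
  · rw [SimpleGraph.adj_comm, SimpleGraph.adj_comm _ (Sum.inr q)]
    exact aux p' q
  · obtain ⟨⟨⟨v, w⟩, hvw⟩, b⟩ := q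
    obtain ⟨⟨⟨v', w'⟩, hvw'⟩, b'⟩ := q'
    rw [perm_inr, perm_inr, blockGraph_adj_inr_inr, blockGraph_adj_inr_inr]
    refine and_congr_right fun h => and_congr_right fun h' => ?_
    obtain rfl : v = w' := h
    obtain rfl : w = v' := h'
    have := hm hvw.ne
    simp only [Matches, blockColor] at this
    simp only [bit_fst, bit_snd]
    by_cases h1 : w ∈ g.flips v <;> by_cases h2 : v ∈ g.flips w <;>
      by_cases h3 : s(v, w) ∈ T <;> by_cases h4 : s(v, w) ∈ T' <;>
      simp_all <;> cases b <;> cases b' <;> simp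

end BlockFlip

/-! ### The pebble game on `χ` over a complete graph -/

/-- The pebbled nodes correspond under a flip that respects all edges not incident with some
block `c` free of pebbles. -/
def ChiRel (T T' : Set (Sym2 V)) (k : ℕ)
    (y y' : Fin k → BlockNode (⊤ : SimpleGraph V) EvenCard) : Prop :=
  ∃ (g : BlockFlip (⊤ : SimpleGraph V) EvenCard) (c : V),
    (∀ v w, v ≠ w → v ≠ c → w ≠ c → g.Matches T T' v w) ∧
    (∀ i, (blockColor _ _ (y i)).1 ≠ c) ∧ ∀ i, y' i = g.perm (y i)

/-- The position `d` is left unconstrained, so it can be used to correct the parity. -/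
lemma exists_even_finset_eq_off [Fintype V] {c d : V} (hcd : d ≠ c) (Q : V → Prop) :
    ∃ S : Finset V, Even S.card ∧ c ∉ S ∧ ∀ w, w ≠ c → w ≠ d → (w ∈ S ↔ Q w) := by
  classical
  let N : Finset V := Finset.univ.filter fun w => w ≠ c ∧ w ≠ d ∧ Q w
  by_cases hN : Even N.card
  · exact ⟨N, hN, by simp [N], fun w h1 h2 => by simp [N, h1, h2]⟩
  · refine ⟨insert d N, ?_, by simp [N, hcd.symm], fun w h1 h2 => by simp [N, h1, h2]⟩
    rw [Finset.card_insert_of_notMem (by simp [N])]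
    exact (Nat.not_even_iff_odd.1 hN).add_one

lemma chiRel_step [Fintype V] {k : ℕ} (hk : k < Fintype.card V) {T T' : Set (Sym2 V)}
    {y y' : Fin k → BlockNode (⊤ : SimpleGraph V) EvenCard} (h : ChiRel T T' k y y') (i : Fin k) :
    ∃ f : Equiv.Perm (BlockNode (⊤ : SimpleGraph V) EvenCard), ∀ w,
      ChiRel T T' k (Function.update y i w) (Function.update y' i (f w)) := by
  obtain ⟨g, c, hm, hc, hy⟩ := h
  -- The block `c` and the blocks of the `k - 1` pebbles that stay make up at most `k` blocks, so
  -- another one is left.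
  obtain ⟨d, hd⟩ : ∃ d, d ∉ insert c
      ((Finset.univ.erase i).image fun j => (blockColor _ _ (y j)).1) := by
    by_contra! hall
    have h1 := (Finset.card_le_card (fun d _ => hall d :
      (Finset.univ : Finset V) ⊆ _)).trans (Finset.card_insert_le _ _)
    have h2 := Finset.card_image_le (s := Finset.univ.erase i)
      (f := fun j => (blockColor _ _ (y j)).1)
    rw [Finset.card_erase_of_mem (Finset.mem_univ i), Finset.card_univ, Fintype.card_fin] at h2
    rw [Finset.card_univ] at h1
    have := i.pos
    omega
  rw [Finset.mem_insert, not_or, Finset.mem_image] at hd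
  obtain ⟨hdc, hdy⟩ := hd
  have hdy : ∀ j, j ≠ i → (blockColor _ _ (y j)).1 ≠ d := fun j hj h => hdy ⟨j, by simp [hj], h⟩
  -- The flip at `c` is redone so that all edges at `c` match except possibly `cd`, which is
  -- harmless once `d` is the free block.
  obtain ⟨S, hS, hcS, hSQ⟩ := exists_even_finset_eq_off hdc fun w =>
    (c ∈ g.flips w ↔ (s(c, w) ∈ T ↔ s(c, w) ∈ T'))
  let g' : BlockFlip (⊤ : SimpleGraph V) EvenCard :=
    { flips := Function.update g.flips c S
      adj := fun v w hw => by
        rcases eq_or_ne v c with rfl | hv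
        · rw [Function.update_self] at hw
          exact fun h => hcS (h ▸ hw)
        · rw [Function.update_of_ne hv] at hw
          exact g.adj v w hw
      pres := fun v U hU => by
        rcases eq_or_ne v c with rfl | hv
        · rw [Function.update_self]
          exact (Finset.even_card_symmDiff U S).2 (iff_of_true hU hS)
        · rw [Function.update_of_ne hv]
          exact g.pres v U hU }
  have hgc : g'.flips c = S := Function.update_self _ _ _
  have hg : ∀ v, v ≠ c → g'.flips v = g.flips v := fun v hv => Function.update_of_ne hv _ _
  have hperm : ∀ x, (blockColor _ _ x).1 ≠ c → g'.perm x = g.perm x := fun x hx =>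
    BlockFlip.perm_congr (hg _ hx)
  -- One bijection serves both cases: outside `c` the two flips act alike, so a pebble that avoids
  -- `c` leaves `g` and `c` valid.
  refine ⟨g'.perm, fun w => ?_⟩
  by_cases hw : (blockColor _ _ w).1 = c
  · refine ⟨g', d, fun v u hvu hv hu => ?_, fun j => ?_, fun j => ?_⟩
    · rcases eq_or_ne v c with rfl | hvc
      · have := hSQ u hvu.symm hu
        rw [BlockFlip.Matches, hgc, hg u hvu.symm, this]
        tauto
      · rcases eq_or_ne u c with rfl | huc
        · have := hSQ v hvu hv
          rw [BlockFlip.Matches, hgc, hg v hvu, this, Sym2.eq_swap (a := v)]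
          tauto
        · rw [BlockFlip.Matches, hg v hvc, hg u huc]
          exact hm v u hvu hvc huc
    · rcases eq_or_ne j i with rfl | hj
      · rw [Function.update_self, hw]
        exact Ne.symm hdc
      · rw [Function.update_of_ne hj]
        exact hdy j hj
    · rcases eq_or_ne j i with rfl | hj
      · rw [Function.update_self, Function.update_self]
      · rw [Function.update_of_ne hj, Function.update_of_ne hj, hy, hperm _ (hc j)]
  · refine ⟨g, c, hm, fun j => ?_, fun j => ?_⟩
    · rcases eq_or_ne j i with rfl | hj
      · rwa [Function.update_self]
      · rw [Function.update_of_ne hj]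
        exact hc j
    · rcases eq_or_ne j i with rfl | hj
      · rw [Function.update_self, Function.update_self, hperm _ hw]
      · rw [Function.update_of_ne hj, Function.update_of_ne hj, hy]

lemma backForth_chiRel [Fintype V] {k : ℕ} (hk : k < Fintype.card V) (T T' : Set (Sym2 V)) :
    LGraph.BackForth (chi (⊤ : SimpleGraph V) T) (chi (⊤ : SimpleGraph V) T') k
      (ChiRel T T' k) where
  iso := by
    rintro y y' ⟨g, c, hm, hc, hy⟩
    obtain rfl : y' = fun i => g.perm (y i) := funext hy
    refine LGraph.isoType_eq_iff.2 ⟨fun i j => g.perm.injective.eq_iff.symm,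
      fun i => (g.blockColor_perm (y i)).symm, fun i j => (g.adj_perm_iff fun hij => ?_).symm⟩
    exact hm _ _ hij (hc i) (hc j)
  step := fun y y' h i => chiRel_step hk h i

/-- Graphs that differ in the twist of a single edge have corresponding tuples. -/
lemma exists_chiRel {T T' : Set (Sym2 V)} (k : ℕ) {p q : V} (hpq : p ≠ q)
    (hT : ∀ x, x ≠ s(p, q) → (x ∈ T ↔ x ∈ T')) : ∃ y y', ChiRel T T' k y y' := by
  let g : BlockFlip (⊤ : SimpleGraph V) EvenCard :=
    { flips := fun _ => ∅
      adj := by simp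
      pres := fun v S hS => by rwa [show symmDiff S ∅ = S from symmDiff_bot S] }
  -- Without any flip only the edge `pq` can mismatch, and it is incident with the free block `p`;
  -- all pebbles sit on a bit of `q`.
  refine ⟨fun _ => .inr (⟨(q, p), hpq.symm⟩, false), _, g, p, fun v w hvw hv hw => ?_,
    fun i => hpq.symm, fun i => rfl⟩
  refine iff_of_true (by simp [g]) (hT _ fun h => ?_)
  have : p ∈ s(v, w) := h ▸ Sym2.mem_mk_left p q
  rcases Sym2.mem_iff.1 this with h | h
  · exact hv h.symm
  · exact hw h.symm

end Blocks

lemma exists_forall_ne_of_card_lt {V : Type*} [Fintype V] {l : ℕ} (hl : l < Fintype.card V)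
    (b : Fin l → V) : ∃ c, ∀ i, b i ≠ c := by
  by_contra! h
  have := Fintype.card_le_of_surjective b h
  rw [Fintype.card_fin] at this
  omega

section Flips

/-! ### Correspondence of tuples in `γ` -/

variable {V : Type} [DecidableEq V] {a k : ℕ} {B : SimpleGraph V}

/-- A flip, extended by the identity on the branches. -/
def gammaPerm (a : ℕ) (g : BlockFlip B (fun _ => True)) : Equiv.Perm (GammaNode a B) :=
  Equiv.sumCongr g.perm (Equiv.prodCongr g.bin (Equiv.refl _))

@[simp] lemma gammaPerm_gammaPerm (g : BlockFlip B (fun _ => True)) (x : GammaNode a B) :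
    gammaPerm a g (gammaPerm a g x) = x := by
  rcases x with x | ⟨s, x⟩ <;> simp [gammaPerm]

/-- Nodes outside the branches correspond under the flip `g`, and nodes in the branch of a string
`s` are part of a pair of tuples in the relation `R s`. -/
def GammaRel (g : BlockFlip B (fun _ => True))
    (R : BinNode B (fun _ => True) → (Fin k → BranchNode a) → (Fin k → BranchNode a) → Prop)
    (v v' : Fin k → GammaNode a B) : Prop :=
  ∃ Y Y' : BinNode B (fun _ => True) → Fin k → BranchNode a, (∀ s, R s (Y s) (Y' s)) ∧
    (∀ i x, v i = .inl x → v' i = .inl (g.perm x)) ∧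
    ∀ i s x, v i = .inr (s, x) → x = Y s i ∧ v' i = .inr (g.bin s, Y' s i)

variable {g : BlockFlip B (fun _ => True)}
  {R : BinNode B (fun _ => True) → (Fin k → BranchNode a) → (Fin k → BranchNode a) → Prop}

/-- A move into a branch is answered by the strategy of that branch alone. Entries of `Y` and `Y'`
at pebbles outside the branch are placeholders that keep its tuples complete. -/
lemma gammaRel_step {v v' : Fin k → GammaNode a B} (h : GammaRel g R v v') (i : Fin k)
    (hR : ∀ s y y', R s y y' → ∃ f : Equiv.Perm (BranchNode a), ∀ x,
      R s (Function.update y i x) (Function.update y' i (f x))) :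
    ∃ f : Equiv.Perm (GammaNode a B), ∀ w,
      GammaRel g R (Function.update v i w) (Function.update v' i (f w)) := by
  classical
  obtain ⟨Y, Y', hY, hl, hr⟩ := h
  choose f hf using fun s => hR s _ _ (hY s)
  refine ⟨Equiv.sumCongr g.perm (Equiv.prodShear g.bin f), ?_⟩
  rintro (z | ⟨t, z⟩)
  · refine ⟨Y, Y', hY, fun j x hj => ?_, fun j s x hj => ?_⟩
    · rcases eq_or_ne j i with rfl | hji
      · rw [Function.update_self] at hj ⊢
        obtain rfl := Sum.inl_injective hj
        rfl
      · rw [Function.update_of_ne hji] at hj ⊢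
        exact hl j x hj
    · rcases eq_or_ne j i with rfl | hji
      · rw [Function.update_self] at hj
        exact absurd hj Sum.inl_ne_inr
      · rw [Function.update_of_ne hji] at hj ⊢
        exact hr j s x hj
  · refine ⟨Function.update Y t (Function.update (Y t) i z),
      Function.update Y' t (Function.update (Y' t) i (f t z)), fun s => ?_, fun j x hj => ?_,
      fun j s x hj => ?_⟩
    · rcases eq_or_ne s t with rfl | hs
      · rw [Function.update_self, Function.update_self]
        exact hf s z
      · rw [Function.update_of_ne hs, Function.update_of_ne hs]
        exact hY s
    · rcases eq_or_ne j i with rfl | hji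
      · rw [Function.update_self] at hj
        exact absurd hj Sum.inr_ne_inl
      · rw [Function.update_of_ne hji] at hj ⊢
        exact hl j x hj
    · rcases eq_or_ne j i with rfl | hji
      · rw [Function.update_self] at hj ⊢
        obtain ⟨rfl, rfl⟩ := Prod.mk.inj (Sum.inr_injective hj)
        rw [Function.update_self, Function.update_self, Function.update_self,
          Function.update_self]
        exact ⟨rfl, rfl⟩
      · rw [Function.update_of_ne hji] at hj ⊢
        rcases eq_or_ne s t with rfl | hs
        · rw [Function.update_self, Function.update_self, Function.update_of_ne hji,
            Function.update_of_ne hji]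
          exact hr j s x hj
        · rw [Function.update_of_ne hs, Function.update_of_ne hs]
          exact hr j s x hj

/-- In a branch with a label, `R s` forces equality, and `gammaPerm` does not move positions within
branches; hence labels and pebbles are carried along alike. -/
lemma gammaRel_label_iff {l : ℕ} {u : Fin l → GammaNode a B}
    (hu : ∀ j s x, u j = .inr (s, x) → ∀ y y', R s y y' → y = y')
    {v v' : Fin k → GammaNode a B} (h : GammaRel g R v v') (i : Fin k) (j : Fin l) :
    u j = v i ↔ gammaPerm a g (u j) = v' i := by
  obtain ⟨Y, Y', hY, hl, hr⟩ := h
  rcases hi : v i with x | ⟨s, x⟩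
  · rw [hl i x hi, ← (gammaPerm a g).injective.eq_iff]
    rfl
  · obtain ⟨rfl, hi'⟩ := hr i s x hi
    rw [hi']
    rcases hj : u j with y | ⟨t, y⟩
    · exact iff_of_false Sum.inl_ne_inr Sum.inl_ne_inr
    · change _ ↔ (Sum.inr (g.bin t, y) : GammaNode a B) = _
      rw [Sum.inr_injective.eq_iff, Sum.inr_injective.eq_iff, Prod.mk_inj, Prod.mk_inj,
        g.bin.injective.eq_iff]
      refine and_congr_right ?_
      rintro rfl
      rw [hu j t y hj _ _ (hY t)]

/-- The block of the base graph to which a node of `γ` belongs. -/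
def gammaBlock (x : GammaNode a B) : V := (gammaColor a B x).1

@[simp] lemma gammaBlock_gammaPerm (g : BlockFlip B (fun _ => True)) (x : GammaNode a B) :
    gammaBlock (gammaPerm a g x) = gammaBlock x := by
  rcases x with x | ⟨s, x⟩
  · exact congrArg (Prod.fst : V × Option V → V) (g.blockColor_perm x)
  · rfl

/-! ### Moving the twist into a given block -/

/-- For `c = p`, one flip at the end `p` of `pq` is enough. Otherwise `p` is flipped towards both
`q` and `c`, and `c` towards `p`: the edge `pc` changes at both ends, hence not at all, and the odd
flip has moved to `c`. If `c = q`, the two positions at `p` cancel in the symmetric difference. -/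
lemma exists_flip_singleton {p q : V} (hpq : p ≠ q) (c : V) :
    ∃ g : BlockFlip (⊤ : SimpleGraph V) (fun _ => True),
      (∀ v w, v ≠ w → g.Matches ∅ {s(p, q)} v w) ∧ ∀ v, v ≠ c → Even (g.flips v).card := by
  have hqp := hpq.symm
  by_cases hc : c = p
  · subst hc
    refine ⟨⟨fun v => if v = c then {q} else ∅, fun v w hw => ?_, fun _ _ _ => trivial⟩,
      fun v w hvw => ?_, fun v hv => by simp [hv]⟩
    · split_ifs at hw with h
      · rw [Finset.mem_singleton.1 hw, h]
        exact hpq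
      · simp at hw
    · simp only [BlockFlip.Matches, Set.mem_empty_iff_false, Set.mem_singleton_iff, false_iff,
        Sym2.eq_iff]
      by_cases h1 : v = c <;> by_cases h2 : w = c <;> simp_all
  · refine ⟨⟨fun v => if v = p then symmDiff {q} {c} else if v = c then {p} else ∅,
      fun v w hw => ?_, fun _ _ _ => trivial⟩, fun v w hvw => ?_, fun v hv => ?_⟩
    · split_ifs at hw with h h'
      · subst h
        rcases Finset.mem_symmDiff.1 hw with h | h <;> have := Finset.mem_singleton.1 h.1
        · rw [this]; exact hpq
        · rw [this]; exact Ne.symm hc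
      · subst h'
        rw [Finset.mem_singleton.1 hw]
        exact hc
      · simp at hw
    · simp only [BlockFlip.Matches, Set.mem_empty_iff_false, Set.mem_singleton_iff, false_iff,
        Sym2.eq_iff]
      by_cases h1 : v = p
      · subst h1
        by_cases h2 : w = c
        · subst h2
          by_cases h3 : w = q <;> simp_all [Finset.mem_symmDiff]
        · by_cases h3 : w = q <;> simp_all [Finset.mem_symmDiff, Ne.symm hvw]
      · by_cases h2 : w = p
        · subst h2
          by_cases h3 : v = q <;> by_cases h4 : v = c <;> simp_all [Finset.mem_symmDiff]
        · by_cases h3 : v = c <;> by_cases h4 : w = c <;> simp_all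
    · dsimp only
      split_ifs with h
      · rw [Finset.even_card_symmDiff]; simp
      · simp

end Flips

section Gamma

/-! ### Adjacency in `γ` -/

variable {V : Type} {a : ℕ} {e : Sym2 (Fin (a + 1))} {B : SimpleGraph V} {T : Set (Sym2 V)}

open Classical in
/-- The twisted edges in the branch of the string `p`. -/
noncomputable def branchTwist (e : Sym2 (Fin (a + 1))) (p : BinNode B (fun _ => True)) :
    Set (Sym2 (Fin (a + 1))) :=
  if Even p.1.2.card then {e} else ∅

lemma branchTwist_of_even {p : BinNode B (fun _ => True)} (h : Even p.1.2.card) :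
    branchTwist e p = {e} := if_pos h

lemma branchTwist_of_not_even {p : BinNode B (fun _ => True)} (h : ¬ Even p.1.2.card) :
    branchTwist e p = ∅ := if_neg h

variable [Fintype V]

lemma gamma_adj_inl_inl {x y : BlockNode B (fun _ => True)} :
    (gamma a e B T).graph.Adj (.inl x) (.inl y) ↔ (blockGraph B (fun _ => True) T).Adj x y := by
  simp only [gamma, SimpleGraph.fromRel_adj, gammaRel]
  refine ⟨fun h => h.2.elim id SimpleGraph.Adj.symm, fun h => ⟨fun hxy => h.ne ?_, .inl h⟩⟩
  exact Sum.inl_injective hxy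

lemma gamma_adj_string_branch {p : BinNode B (fun _ => True)}
    {q : BinNode B (fun _ => True) × BranchNode a} :
    (gamma a e B T).graph.Adj (.inl (.inl p)) (.inr q) ↔ p = q.1 := by
  simp only [gamma, SimpleGraph.fromRel_adj, gammaRel]
  exact ⟨fun h => h.2.elim id False.elim, fun h => ⟨Sum.inl_ne_inr, .inl h⟩⟩

lemma gamma_adj_bit_branch {b : BitNode B} {q : BinNode B (fun _ => True) × BranchNode a} :
    ¬ (gamma a e B T).graph.Adj (.inl (.inr b)) (.inr q) := by
  simp only [gamma, SimpleGraph.fromRel_adj, gammaRel]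
  exact fun h => h.2.elim id id

lemma gamma_adj_inr_inr {q r : BinNode B (fun _ => True) × BranchNode a} :
    (gamma a e B T).graph.Adj (.inr q) (.inr r) ↔
      q.1 = r.1 ∧ (blockGraph ⊤ EvenCard (branchTwist e q.1)).Adj q.2 r.2 := by
  simp only [gamma, SimpleGraph.fromRel_adj, gammaRel]
  constructor
  · rintro ⟨-, h | ⟨h1, h2⟩⟩
    · exact h
    · refine ⟨h1.symm, ?_⟩
      rw [← h1]
      exact h2.symm
  · intro h
    refine ⟨fun hqr => h.2.ne ?_, .inl h⟩
    exact congrArg Prod.snd (Sum.inr_injective hqr)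

/-! ### The pebble game on `γ` -/

variable [DecidableEq V] {k : ℕ} {g : BlockFlip B (fun _ => True)}
  {R : BinNode B (fun _ => True) → (Fin k → BranchNode a) → (Fin k → BranchNode a) → Prop}

lemma gammaRel_iso {T' : Set (Sym2 V)} (hg : ∀ v w, v ≠ w → g.Matches T T' v w)
    (hR : ∀ s y y', R s y y' → (chi ⊤ (branchTwist e s)).isoType y =
      (chi ⊤ (branchTwist e (g.bin s))).isoType y')
    {v v' : Fin k → GammaNode a B} (h : GammaRel g R v v') :
    (gamma a e B T).isoType v = (gamma a e B T').isoType v' := by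
  obtain ⟨Y, Y', hY, hl, hr⟩ := h
  have hiso := fun s => LGraph.isoType_eq_iff.1 (hR s _ _ (hY s))
  refine LGraph.isoType_eq_iff.2 ⟨fun i j => ?_, fun i => ?_, fun i j => ?_⟩
  · rcases hi : v i with x | ⟨s, x⟩ <;> rcases hj : v j with y | ⟨t, y⟩
    · rw [hl i x hi, hl j y hj]
      exact (Sum.inl_injective.eq_iff.trans
        (g.perm.injective.eq_iff.symm.trans Sum.inl_injective.eq_iff.symm))
    · rw [hl i x hi, (hr j t y hj).2]
      exact iff_of_false Sum.inl_ne_inr Sum.inl_ne_inr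
    · rw [hl j y hj, (hr i s x hi).2]
      exact iff_of_false Sum.inr_ne_inl Sum.inr_ne_inl
    · obtain ⟨rfl, hi'⟩ := hr i s x hi
      obtain ⟨rfl, hj'⟩ := hr j t y hj
      rw [hi', hj']
      change (Sum.inr (s, Y s i) : GammaNode a B) = Sum.inr (t, Y t j) ↔
        (Sum.inr (g.bin s, Y' s i) : GammaNode a B) = Sum.inr (g.bin t, Y' t j)
      rw [Sum.inr_injective.eq_iff, Sum.inr_injective.eq_iff, Prod.mk_inj, Prod.mk_inj,
        g.bin.injective.eq_iff]
      refine and_congr_right ?_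
      rintro rfl
      exact (hiso s).1 i j
  · rcases hi : v i with x | ⟨s, x⟩
    · rw [hl i x hi]
      exact congrArg (fun c : V × Option V => (c.1, Sum.inl c.2)) (g.blockColor_perm x).symm
    · obtain ⟨rfl, hi'⟩ := hr i s x hi
      rw [hi']
      exact congrArg (fun c => (s.1.1, Sum.inr c)) ((hiso s).2.1 i)
  · have aux : ∀ x s i j, v i = .inl x → v j = .inr (s, Y s j) → v' i = .inl (g.perm x) →
        v' j = .inr (g.bin s, Y' s j) → ((gamma a e B T).graph.Adj (v i) (v j) ↔
          (gamma a e B T').graph.Adj (v' i) (v' j)) := by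
      intro x s i j hi hj hi' hj'
      rw [hi, hj, hi', hj']
      rcases x with p | b
      · rw [BlockFlip.perm_inl, gamma_adj_string_branch, gamma_adj_string_branch]
        exact g.bin.injective.eq_iff.symm
      · exact iff_of_false gamma_adj_bit_branch gamma_adj_bit_branch
    rcases hi : v i with x | ⟨s, x⟩ <;> rcases hj : v j with y | ⟨t, y⟩
    · rw [hl i x hi, hl j y hj, gamma_adj_inl_inl, gamma_adj_inl_inl]
      exact (g.adj_perm_iff fun h => hg _ _ h).symm
    · obtain ⟨rfl, hj'⟩ := hr j t y hj
      rw [← hi, ← hj]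
      exact aux x t i j hi hj (hl i x hi) hj'
    · obtain ⟨rfl, hi'⟩ := hr i s x hi
      rw [← hi, ← hj]
      exact (SimpleGraph.adj_comm _ _ _).trans
        ((aux y s j i hj hi (hl j y hj) hi').trans (SimpleGraph.adj_comm _ _ _))
    · obtain ⟨rfl, hi'⟩ := hr i s x hi
      obtain ⟨rfl, hj'⟩ := hr j t y hj
      rw [hi', hj', gamma_adj_inr_inr, gamma_adj_inr_inr]
      simp only [g.bin.injective.eq_iff]
      refine and_congr_right ?_
      rintro rfl
      exact (hiso s).2.2 i j

lemma backForth_gammaRel {l : ℕ} {T' : Set (Sym2 V)}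
    (hg : ∀ v w, v ≠ w → g.Matches T T' v w)
    (hR : ∀ s, LGraph.BackForth (chi ⊤ (branchTwist e s)) (chi ⊤ (branchTwist e (g.bin s))) k (R s))
    {u : Fin l → GammaNode a B}
    (hu : ∀ j s x, u j = .inr (s, x) → ∀ y y', R s y y' → y = y') :
    LGraph.BackForth ((gamma a e B T).label u)
      ((gamma a e B T').label fun j => gammaPerm a g (u j)) k (GammaRel g R) where
  iso := by
    intro v v' h
    obtain ⟨h1, h2, h3⟩ := LGraph.isoType_eq_iff.1
      (gammaRel_iso (T := T) hg (fun s => (hR s).iso) h)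
    exact LGraph.isoType_eq_iff.2 ⟨h1, fun i => Prod.ext (h2 i) (Set.ext fun j =>
      gammaRel_label_iff hu h i j), h3⟩
  step := fun v v' h i => gammaRel_step h i fun s y y' hs => (hR s).step y y' hs i

/-! ### `γ` with and without a twist -/

/-- Off `c` the flip keeps parities, so matched strings have equal branches and pebbles there are
copied. Over `c` the branches may be of opposite kinds, but no label lies there, and the strategy
for `a` pebbles on `a + 1` blocks applies. -/
lemma wlColor_gamma_label_eq {l t : ℕ} {p q : V} {c : V} (ha : e ∈ (⊤ : SimpleGraph _).edgeSet)
    {g : BlockFlip (⊤ : SimpleGraph V) (fun _ => True)}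
    (hg : ∀ v w, v ≠ w → g.Matches ∅ {s(p, q)} v w)
    (hgc : ∀ v, v ≠ c → Even (g.flips v).card) {u : Fin l → GammaNode a (⊤ : SimpleGraph V)}
    (hu : ∀ i, gammaBlock (u i) ≠ c) :
    ((gamma a e ⊤ ∅).label u).wlColor a t =
      ((gamma a e ⊤ {s(p, q)}).label fun j => gammaPerm a g (u j)).wlColor a t := by
  classical
  induction e using Sym2.ind with | _ x y => ?_
  have hxy : x ≠ y := ha
  let R : BinNode (⊤ : SimpleGraph V) (fun _ => True) →
      (Fin a → BranchNode a) → (Fin a → BranchNode a) → Prop := fun s =>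
    if s.1.1 = c then ChiRel (branchTwist s(x, y) s) (branchTwist s(x, y) (g.bin s)) a else (· = ·)
  have htw : ∀ (s : BinNode (⊤ : SimpleGraph V) (fun _ => True)) z, z ≠ s(x, y) →
      z ∉ branchTwist s(x, y) s := by
    intro s z hz
    by_cases h : Even s.1.2.card
    · rwa [branchTwist_of_even h]
    · rw [branchTwist_of_not_even h]; simp
  have hR : ∀ s, LGraph.BackForth (chi ⊤ (branchTwist s(x, y) s))
      (chi ⊤ (branchTwist s(x, y) (g.bin s))) a (R s) := by
    intro s
    by_cases hs : s.1.1 = c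
    · simp only [R, hs, if_true]
      exact backForth_chiRel (by simp) _ _
    · simp only [R, hs, if_false]
      have : branchTwist s(x, y) (g.bin s) = branchTwist s(x, y) s := by
        have h1 : Even (g.bin s).1.2.card ↔ Even s.1.2.card := by
          rw [BlockFlip.bin_snd, Finset.even_card_symmDiff]
          simp [hgc _ hs]
        by_cases h : Even s.1.2.card
        · rw [branchTwist_of_even h, branchTwist_of_even (h1.2 h)]
        · rw [branchTwist_of_not_even h, branchTwist_of_not_even (mt h1.1 h)]
      rw [this]
      exact LGraph.backForth_eq _ _
  have hex : ∀ s, ∃ y y', R s y y' := by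
    intro s
    by_cases hs : s.1.1 = c
    · simp only [R, hs, if_true]
      exact exists_chiRel a hxy fun z hz => iff_of_false (htw _ z hz) (htw _ z hz)
    · simp only [R, hs, if_false]
      exact ⟨fun _ => .inl ⟨(0, ∅), by simp, (by simp : Even (∅ : Finset _).card)⟩, _, rfl⟩
  choose Y Y' hY using hex
  -- All pebbles start outside the branches; the tuples from `hex` are placeholders.
  let z : BlockNode (⊤ : SimpleGraph V) (fun _ => True) := .inl ⟨(p, ∅), by simp⟩
  have hinit : GammaRel g R (fun _ => .inl z) (fun _ => .inl (g.perm z)) :=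
    ⟨Y, Y', hY, fun i z' hz => congrArg (fun z => Sum.inl (g.perm z)) (Sum.inl_injective hz),
      fun i s z hz => absurd hz Sum.inl_ne_inr⟩
  refine (backForth_gammaRel (R := R) hg hR fun j s z hj y y' hs => ?_).wlColor_eq t hinit
  have hs' : s.1.1 ≠ c := by
    have := hu j
    rwa [hj] at this
  simpa only [R, hs', if_false] using hs

theorem not_distinguishes_gamma {l : ℕ} (hl : l < Fintype.card V)
    (ha : e ∈ (⊤ : SimpleGraph _).edgeSet) {f : Sym2 V} (hf : f ∈ (⊤ : SimpleGraph V).edgeSet) :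
    ¬ (klWL a l).Distinguishes (gamma a e (⊤ : SimpleGraph V) ∅) (gamma a e ⊤ {f}) := by
  induction f using Sym2.ind with | _ p q => ?_
  choose c hc using exists_forall_ne_of_card_lt (V := V) hl
  choose g hg hgc using exists_flip_singleton (show p ≠ q from hf)
  let Φ : (Fin l → GammaNode a (⊤ : SimpleGraph V)) → Fin l → GammaNode a (⊤ : SimpleGraph V) :=
    fun u i => gammaPerm a (g (c fun j => gammaBlock (u j))) (u i)
  -- The choice of `c` depends only on the blocks of the labels, which flips preserve; so the second
  -- application uses the same flip.
  have hΦ : Function.Involutive Φ := fun u => by simp [Φ]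
  refine not_not.2 (funext fun t => LGraph.klColor_eq_iff.2 ⟨hΦ.toPerm, fun u => ?_⟩)
  exact wlColor_gamma_label_eq ha (hg _) (hgc _) (hc fun j => gammaBlock (u j))

end Gamma

/-! ### Parity of the strings -/

/-- If membership of `w` in `S v` is symmetric except at the pair `p, q`, then some `S v` is odd. -/
lemma exists_not_even_card {V : Type*} [Fintype V] [DecidableEq V] {S : V → Finset V} {p q : V}
    (hpq : p ≠ q) (hS : ∀ v, v ∉ S v)
    (h : ∀ v w, v ≠ w → ((w ∈ S v ↔ v ∈ S w) ↔ s(v, w) ≠ s(p, q))) :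
    ∃ v, ¬ Even (S v).card := by
  classical
  wlog hq : q ∈ S p generalizing p q
  · refine this hpq.symm (fun v w hvw => by rw [h v w hvw, Sym2.eq_swap (a := q)]) ?_
    have := h p q hpq
    tauto
  have hp : p ∉ S q := by
    have := h p q hpq
    tauto
  by_contra! hev
  -- Without the pair `pq`, membership is symmetric. The degrees of this graph are the cardinalities
  -- of the sets, except for one less at `p`; if all sets were even, `p` would be the only node of
  -- odd degree.
  let A : SimpleGraph V :=
    { Adj := fun v w => w ∈ S v ∧ s(v, w) ≠ s(p, q)
      symm := ⟨fun v w hvw => by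
        have hne : v ≠ w := fun h => hS v (h ▸ hvw.1)
        exact ⟨((h v w hne).2 hvw.2).1 hvw.1, by rw [Sym2.eq_swap]; exact hvw.2⟩⟩
      loopless := ⟨fun v hv => hS v hv.1⟩ }
  have h1 : A.neighborFinset p = (S p).erase q := by
    ext w
    rw [SimpleGraph.mem_neighborFinset, Finset.mem_erase]
    change w ∈ S p ∧ s(p, w) ≠ s(p, q) ↔ _
    rw [and_comm, Ne, Sym2.congr_right]
  have h2 : ∀ v, v ≠ p → A.neighborFinset v = S v := by
    intro v hv
    ext w
    rw [SimpleGraph.mem_neighborFinset]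
    refine ⟨fun hw => hw.1, fun hw => ⟨hw, fun he => ?_⟩⟩
    rcases Sym2.eq_iff.1 he with ⟨h1, -⟩ | ⟨h1, h2⟩
    · exact hv h1
    · exact hp (h1 ▸ h2 ▸ hw)
  have hodd : Odd (A.degree p) := by
    have h3 := Finset.card_erase_add_one hq
    have h4 := hev p
    rw [SimpleGraph.degree, h1, ← Nat.not_even_iff_odd]
    rw [← h3, Nat.even_add_one] at h4
    exact h4
  obtain ⟨w, hw, hw'⟩ := A.exists_ne_odd_degree_of_exists_odd_degree p hodd
  rw [SimpleGraph.degree, h2 w hw, ← Nat.not_even_iff_odd] at hw'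
  exact hw' (hev w)

lemma exists_ne_and_ne {a : ℕ} (ha : 2 ≤ a) (i j : Fin (a + 1)) : ∃ m, m ≠ i ∧ m ≠ j := by
  obtain ⟨m, hm⟩ := exists_forall_ne_of_card_lt (l := 2) (by simpa using ha) ![i, j]
  exact ⟨m, (hm 0).symm, (hm 1).symm⟩

/-! ### ### Detecting the twist with `a + 1` pebbles -/

section Distinguish

variable {V : Type} {a : ℕ} {e : Sym2 (Fin (a + 1))} {B : SimpleGraph V} {T : Set (Sym2 V)}
  {P : Finset V → Prop}

/-- A path between two strings through the bits of their edge shows how these bits compare. -/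
lemma mem_iff_mem_of_path {p q : BinNode B P} {x y : BlockNode B P}
    (hx : blockColor B P x = (p.1.1, some q.1.1)) (hy : blockColor B P y = (q.1.1, some p.1.1))
    (h1 : (blockGraph B P T).Adj (.inl p) x) (h2 : (blockGraph B P T).Adj x y)
    (h3 : (blockGraph B P T).Adj y (.inl q)) :
    (q.1.1 ∈ p.1.2 ↔ p.1.1 ∈ q.1.2) ↔ s(p.1.1, q.1.1) ∉ T := by
  obtain ⟨hpq, b, rfl⟩ := blockColor_eq_some hx
  obtain ⟨hqp, b', rfl⟩ := blockColor_eq_some hy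
  have h1 := (blockGraph_adj_inl_inr.1 h1).2
  have h2 := (blockGraph_adj_inr_inr.1 h2).2.2
  have h3 := (blockGraph_adj_inl_inr.1 h3.symm).2
  dsimp only at h1 h2 h3
  rw [← h1, ← h3, ← h2]
  cases b <;> cases b' <;> simp

lemma exists_path_of_notMem {v w : V} (hvw : B.Adj v w) (hT : s(v, w) ∉ T)
    {p q : BinNode B P} (hp : p.1 = (v, ∅)) (hq : q.1 = (w, ∅)) :
    ∃ x y, blockColor B P x = (v, some w) ∧ blockColor B P y = (w, some v) ∧
      (blockGraph B P T).Adj (.inl p) x ∧ (blockGraph B P T).Adj x y ∧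
      (blockGraph B P T).Adj y (.inl q) := by
  refine ⟨.inr (⟨(v, w), hvw⟩, false), .inr (⟨(w, v), hvw.symm⟩, false), rfl, rfl,
    blockGraph_adj_inl_inr.2 ?_, blockGraph_adj_inr_inr.2 ⟨rfl, rfl, iff_of_true rfl hT⟩,
    (blockGraph_adj_inl_inr.2 ?_).symm⟩ <;> simp [hp, hq]

lemma gammaColor_eq_inl {z : GammaNode a B} {v : V} {c : Option V}
    (h : gammaColor a B z = (v, .inl c)) : ∃ x, z = .inl x ∧ blockColor B _ x = (v, c) := by
  rcases z with x | q
  · obtain ⟨h1, h2⟩ := Prod.ext_iff.1 h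
    exact ⟨x, rfl, Prod.ext h1 (Sum.inl_injective h2)⟩
  · exact absurd (congrArg Prod.snd h) (by simp [gammaColor])

lemma gammaColor_eq_inr {z : GammaNode a B} {v : V} {c : Fin (a + 1) × Option (Fin (a + 1))}
    (h : gammaColor a B z = (v, .inr c)) :
    ∃ s x, z = .inr (s, x) ∧ blockColor _ _ x = c := by
  rcases z with x | ⟨s, x⟩
  · exact absurd (congrArg Prod.snd h) (by simp [gammaColor])
  · exact ⟨s, x, rfl, Sum.inr_injective (congrArg Prod.snd h)⟩

variable [Fintype V]

/-- A tuple color of a string determines the parity of the string. -/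
lemma not_even_of_equi (ha : 2 ≤ a) (he : e ∈ (⊤ : SimpleGraph _).edgeSet) {T' : Set (Sym2 V)}
    {l : ℕ} {u u' : Fin l → GammaNode a B} {w w' : Fin (a + 1) → GammaNode a B}
    (h : LGraph.Equi ((gamma a e B T).label u) ((gamma a e B T').label u') (a + 1) w w')
    {i : Fin (a + 1)} {s s' : BinNode B (fun _ => True)} (hi : w i = .inl (.inl s))
    (hi' : w' i = .inl (.inl s')) (hs : ¬ Even s.1.2.card) : ¬ Even s'.1.2.card := by
  intro hs'
  have hthird := exists_ne_and_ne ha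
  let r : Fin (a + 1) → BinNode (⊤ : SimpleGraph (Fin (a + 1))) EvenCard := fun j =>
    ⟨(j, ∅), by simp, (by simp : Even (∅ : Finset _).card)⟩
  let z : Fin (a + 1) → GammaNode a B := fun j => .inr (s, .inl (r j))
  -- Pebble `i` stays on `s` for now, so that adjacency to it forces the other replies into the
  -- branch of `s'`.
  obtain ⟨z₁, hz₁, hz₁'⟩ := h.forth_finset (Finset.univ.erase i) z
  have hyi : (Finset.univ.erase i).piecewise z w i = .inl (.inl s) := by
    rw [Finset.piecewise_eq_of_notMem _ _ _ (by simp), hi]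
  have hyj : ∀ j, j ≠ i → (Finset.univ.erase i).piecewise z w j = z j := fun j hj =>
    Finset.piecewise_eq_of_mem _ _ _ (by simp [hj])
  have hz₁i : z₁ i = .inl (.inl s') := (hz₁' i (by simp)).trans hi'
  obtain ⟨b, hb⟩ := hz₁.forth i (z i)
  have hupd : Function.update ((Finset.univ.erase i).piecewise z w) i (z i) = z := by
    funext j
    rcases eq_or_ne j i with rfl | hj
    · exact Function.update_self _ _ _
    · exact (Function.update_of_ne hj _ _).trans (hyj j hj)
  obtain ⟨z₂, hz₂, hz₂j⟩ : ∃ z₂ : Fin (a + 1) → GammaNode a B,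
      LGraph.Equi ((gamma a e B T).label u) ((gamma a e B T').label u') (a + 1) z z₂ ∧
      ∀ j, j ≠ i → z₂ j = z₁ j :=
    ⟨_, hupd ▸ hb, fun j hj => Function.update_of_ne hj _ _⟩
  have hcol : ∀ j, ∃ t x, z₂ j = .inr (t, x) ∧ blockColor _ _ x = (j, none) := fun j =>
    gammaColor_eq_inr (congrArg Prod.fst (hz₂.X_eq j))
  have hin : ∀ j, ∃ S hS, z₂ j = .inr (s', .inl ⟨(j, S), hS⟩) := by
    have hne : ∀ j, j ≠ i → ∃ S hS, z₂ j = .inr (s', .inl ⟨(j, S), hS⟩) := by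
      intro j hj
      obtain ⟨t, x, hx, hc⟩ := hcol j
      obtain ⟨S, hS, rfl⟩ := blockColor_eq_none hc
      have hadj₀ : (gamma a e B T).graph.Adj ((Finset.univ.erase i).piecewise z w i)
          ((Finset.univ.erase i).piecewise z w j) := by
        rw [hyi, hyj j hj]
        exact gamma_adj_string_branch.2 rfl
      have hadj : (gamma a e B T').graph.Adj (z₁ i) (z₁ j) := hz₁.adj hadj₀
      rw [hz₁i, ← hz₂j j hj, hx] at hadj
      obtain rfl : s' = t := gamma_adj_string_branch.1 hadj
      exact ⟨S, hS, hx⟩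
    intro j
    rcases eq_or_ne j i with rfl | hj
    · obtain ⟨m, hm, -⟩ := hthird j j
      obtain ⟨m', hm', hm''⟩ := hthird m j
      obtain ⟨S', hS', hzm⟩ := hne m hm
      obtain ⟨t, x, hx, hc⟩ := hcol j
      obtain ⟨S, hS, rfl⟩ := blockColor_eq_none hc
      -- The pebble that has left `s` is located through a common neighbor with another one: by its
      -- color this neighbor is a string, and a string sees no branch but its own.
      obtain ⟨c, hc, hc1, hc2⟩ := hz₂.exists_common_neighbor hm' hm'' (a := .inl (.inl s))
        (SimpleGraph.Adj.symm (gamma_adj_string_branch.2 rfl)) (gamma_adj_string_branch.2 rfl)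
      obtain ⟨c, rfl, hcB⟩ := gammaColor_eq_inl (congrArg Prod.fst hc)
      obtain ⟨C, hC, rfl⟩ := blockColor_eq_none hcB
      rw [hzm] at hc1
      rw [hx] at hc2
      have h1 := gamma_adj_string_branch.1 (SimpleGraph.Adj.symm hc1)
      have h2 := gamma_adj_string_branch.1 hc2
      obtain rfl : t = s' := h2.symm.trans h1
      exact ⟨S, hS, hx⟩
    · exact hne j hj
  choose S hS hz using hin
  induction e using Sym2.ind with | _ x y => ?_
  -- The branch of the odd string `s` is untwisted, so its empty strings are pairwise linked through
  -- their bits. In the twisted branch of `s'` these links make the replies agree except at the edge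
  -- `e`; then one reply is odd, but `χ` has only even strings.
  obtain ⟨j, hj⟩ := exists_not_even_card (S := S) (show x ≠ y from he)
    (fun v hv => (hS v).1 v hv rfl) fun j j' hjj' => by
      obtain ⟨m, hm, hm'⟩ := hthird j j'
      obtain ⟨c, d, hc, hd, h1, h2, h3⟩ := exists_path_of_notMem (B := ⊤) (P := EvenCard)
        (T := branchTwist s(x, y) s) hjj' (by rw [branchTwist_of_not_even hs]; simp)
        (p := r j) (q := r j') rfl rfl
      obtain ⟨c', d', hc', hd', h1', h2', h3'⟩ := hz₂.exists_path hm hm' hjj'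
        (a := .inr (s, c)) (b := .inr (s, d)) (gamma_adj_inr_inr.2 ⟨rfl, h1⟩)
        (gamma_adj_inr_inr.2 ⟨rfl, h2⟩) (gamma_adj_inr_inr.2 ⟨rfl, h3⟩)
      obtain ⟨t, c', rfl, hcB⟩ := gammaColor_eq_inr (congrArg Prod.fst hc')
      obtain ⟨t', d', rfl, hdB⟩ := gammaColor_eq_inr (congrArg Prod.fst hd')
      rw [hz] at h1' h3'
      obtain ⟨e1, h1'⟩ := gamma_adj_inr_inr.1 h1'
      obtain ⟨e2, h2'⟩ := gamma_adj_inr_inr.1 h2'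
      obtain ⟨e3, h3'⟩ := gamma_adj_inr_inr.1 h3'
      obtain rfl : s' = t := e1
      obtain rfl : s' = t' := e2
      have := mem_iff_mem_of_path (hcB.trans hc) (hdB.trans hd) h1' h2' h3'
      rwa [branchTwist_of_even hs'] at this
  exact hj (hS j).2

/-- By `σ`, each block receives one label or pebble, on its empty string. Every test of a parity or
of an edge restarts from this same position `h`, so the pebbles moved in one test are not missing in
another. -/
theorem distinguishes_gamma (ha : 2 ≤ a) {l : ℕ} (σ : Fin l ⊕ Fin (a + 1) ≃ V)
    (he : e ∈ (⊤ : SimpleGraph _).edgeSet) {f : Sym2 V} (hf : f ∈ (⊤ : SimpleGraph V).edgeSet) :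
    (klWL (a + 1) l).Distinguishes (gamma a e (⊤ : SimpleGraph V) ∅) (gamma a e ⊤ {f}) := by
  classical
  intro hcol
  let r : Fin l ⊕ Fin (a + 1) → BinNode (⊤ : SimpleGraph V) (fun _ => True) := fun i =>
    ⟨(σ i, ∅), by simp⟩
  obtain ⟨u', v', h⟩ := LGraph.exists_equi_of_color_eq hcol
    (fun i => .inl (.inl (r (.inl i)))) (fun i => .inl (.inl (r (.inr i))))
  let N : Fin l ⊕ Fin (a + 1) → GammaNode a (⊤ : SimpleGraph V) := Sum.elim u' v'
  have hpair : ∀ {p q : Fin l ⊕ Fin (a + 1)}, p ≠ q →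
      ∃ (i j : Fin (a + 1)) (w w' : Fin (a + 1) → GammaNode a (⊤ : SimpleGraph V)), i ≠ j ∧
        LGraph.Equi ((gamma a e ⊤ ∅).label fun i => .inl (.inl (r (.inl i))))
          ((gamma a e ⊤ {f}).label u') (a + 1) w w' ∧
        w i = .inl (.inl (r p)) ∧ w' i = N p ∧ w j = .inl (.inl (r q)) ∧ w' j = N q := by
    intro p q hpq
    obtain ⟨i, j, w, w', hij, hw, hi, hi', hj, hj'⟩ :=
      h.exists_pair (by omega : 2 ≤ a + 1) hpq
    exact ⟨i, j, w, w', hij, hw, hi.trans (by rcases p with p | p <;> rfl), hi',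
      hj.trans (by rcases q with q | q <;> rfl), hj'⟩
  have : Nontrivial (Fin (a + 1)) := Fin.nontrivial_iff_two_le.2 (by omega)
  have hstr : ∀ i, ∃ S hS, N i = .inl (.inl ⟨(σ i, S), hS⟩) ∧ Even S.card := by
    intro p
    obtain ⟨q, hq⟩ : ∃ q, q ≠ p := by
      have : Nontrivial (Fin l ⊕ Fin (a + 1)) := Sum.inr_injective.nontrivial
      exact exists_ne p
    obtain ⟨i, j, w, w', -, hw, hi, hi', -⟩ := hpair hq.symm
    have hX := congrArg Prod.fst (hw.X_eq i)
    rw [hi, hi'] at hX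
    obtain ⟨x, hx, hc⟩ := gammaColor_eq_inl hX
    obtain ⟨S, hS, rfl⟩ := blockColor_eq_none hc
    refine ⟨S, hS, hx, ?_⟩
    by_contra hodd
    -- Read backwards: an odd reply would make the empty string odd.
    exact not_even_of_equi ha he hw.symm (hi'.trans hx) hi hodd (by simp [r])
  choose S hS hu hev using hstr
  induction f using Sym2.ind with | _ x y => ?_
  obtain ⟨v, hv⟩ := exists_not_even_card (S := fun v => S (σ.symm v)) (show x ≠ y from hf)
    (fun v hv => by
      have := (hS (σ.symm v)).1 v hv
      rw [Equiv.apply_symm_apply] at this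
      exact this rfl) fun v w hvw => by
      obtain ⟨p, rfl⟩ := σ.surjective v
      obtain ⟨q, rfl⟩ := σ.surjective w
      rw [Equiv.symm_apply_apply, Equiv.symm_apply_apply]
      obtain ⟨i, j, w, w', hij, hw, hi, hi', hj, hj'⟩ := hpair fun h => hvw (congrArg σ h)
      obtain ⟨m, hm, hm'⟩ := exists_ne_and_ne ha i j
      obtain ⟨c, d, hc, hd, h1, h2, h3⟩ := exists_path_of_notMem (B := ⊤) (P := fun _ => True)
        (T := ∅) hvw (by simp) (p := r p) (q := r q) rfl rfl
      rw [hu] at hi' hj'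
      have hic : (gamma a e ⊤ ∅).graph.Adj (w i) (.inl c) := by
        rw [hi]
        exact gamma_adj_inl_inl.2 h1
      have hdj : (gamma a e ⊤ ∅).graph.Adj (.inl d) (w j) := by
        rw [hj]
        exact gamma_adj_inl_inl.2 h3
      obtain ⟨c', d', hc', hd', h1', h2', h3'⟩ :=
        hw.exists_path hm hm' hij hic (gamma_adj_inl_inl.2 h2) hdj
      obtain ⟨c', rfl, hcB⟩ := gammaColor_eq_inl (congrArg Prod.fst hc')
      obtain ⟨d', rfl, hdB⟩ := gammaColor_eq_inl (congrArg Prod.fst hd')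
      rw [hi'] at h1'
      rw [hj'] at h3'
      exact mem_iff_mem_of_path (hcB.trans hc) (hdB.trans hd) (gamma_adj_inl_inl.1 h1')
        (gamma_adj_inl_inl.1 h2') (gamma_adj_inl_inl.1 h3')
  exact hv (hev _)

end Distinguish

theorem mainTheorem1 (k l : ℕ) (hk : 2 ≤ k) :
    (klWL k (l + 1)).Less (klWL (k + 1) l) ∧
    ∀ e ∈ (⊤ : SimpleGraph (Fin (k + 1))).edgeSet,
    ∀ f ∈ (⊤ : SimpleGraph (Fin (k + l + 1))).edgeSet,
      ¬ (klWL k (l + 1)).Distinguishes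
          (gamma k e (⊤ : SimpleGraph (Fin (k + l + 1))) ∅)
          (gamma k e (⊤ : SimpleGraph (Fin (k + l + 1))) {f}) ∧
      (klWL (k + 1) l).Distinguishes
          (gamma k e (⊤ : SimpleGraph (Fin (k + l + 1))) ∅)
          (gamma k e (⊤ : SimpleGraph (Fin (k + l + 1))) {f}) := by
  have hsep : ∀ e ∈ (⊤ : SimpleGraph (Fin (k + 1))).edgeSet,
      ∀ f ∈ (⊤ : SimpleGraph (Fin (k + l + 1))).edgeSet,
      ¬ (klWL k (l + 1)).Distinguishes
          (gamma k e (⊤ : SimpleGraph (Fin (k + l + 1))) ∅)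
          (gamma k e (⊤ : SimpleGraph (Fin (k + l + 1))) {f}) ∧
      (klWL (k + 1) l).Distinguishes
          (gamma k e (⊤ : SimpleGraph (Fin (k + l + 1))) ∅)
          (gamma k e (⊤ : SimpleGraph (Fin (k + l + 1))) {f}) := fun e he f hf =>
    ⟨not_distinguishes_gamma (by rw [Fintype.card_fin]; omega) he hf,
      distinguishes_gamma hk (Fintype.equivOfCardEq (by simp; omega)) he hf⟩
  refine ⟨⟨klWL_lessEq_succ k l, fun h => ?_⟩, hsep⟩
  -- With `k` visibly positive, `0` and the last node are the ends of an edge of the complete graph.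
  obtain ⟨m, rfl⟩ : ∃ m, k = m + 1 := ⟨k - 1, by omega⟩
  obtain ⟨h1, h2⟩ := hsep s(0, Fin.last _) (by simp [Fin.ext_iff]) s(0, Fin.last _)
    (by simp [Fin.ext_iff]; omega)
  exact h2 (h.2 _ _ _ (not_not.1 h1))
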